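/- Let $\Gamma_1,\Gamma_2$ be finitely generated groups such that the free product $\Gamma=\Gamma_1*\Gamma_2$ is non-elementary, that is, both factors are non-trivial and they are not both of order $2$. For a probability measure $\mu$ on $\Gamma$ put $P(x,y)=\mu(x^{-1}y)$, let $P^n$ be its $n$-th power, and let $$R=\Big(\limsup_{n\to\infty}P^n(e,e)^{1/n}\Big)^{-1}.$$ For a subgroup $H\le\Gamma$ let $P_{R,H}$ be the first return kernel to $H$ associated with $R\mu$, that is, for $x,y\in H$, $$P_{R,H}(x,y)=\sum_{n\ge 1}\ \sum_{z_1,\dots,z_{n-1}\in\Gamma\setminus H}R^n\,\mu(x^{-1}z_1)\mu(z_1^{-1}z_2)\cdots\mu(z_{n-1}^{-1}y),$$ and let $R_H(R)=\big(\limsup_{n\to\infty}P_{R,H}^n(e,e)^{1/n}\big)^{-1}$. The measure $\mu$ is called spectrally degenerate along $H$ if $R_H(R)=1$, and spectrally non-degenerate if it is spectrally degenerate along neither of the two free factors $H=\Gamma_1$ and $H=\Gamma_2$. Then there exists a probability measure $\mu$ on $\Gamma$ such that 1. $\mu$ is finitely supported and symmetric ($\mu(g^{-1})=\mu(g)$ for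 all $g\in\Gamma$), and its support generates $\Gamma$ as a semigroup; 2. $\mu$ is adapted: $\mu=\alpha_1\mu_1+\alpha_2\mu_2$ with $\alpha_1,\alpha_2\ge 0$, $\alpha_1+\alpha_2=1$, where each $\mu_i$ is a finitely supported, symmetric probability measure on $\Gamma_i\le\Gamma$ whose support generates $\Gamma_i$ as a semigroup; 3. $\mu$ is spectrally non-degenerate. -/

import Mathlib

open Filter
open scoped ENNReal

noncomputable section

namespace RatioLimit

/-- The `n`-th power of a non-negative kernel `K` on a set `X`. -/
def kernelPow {X : Type*} (K : X → X → ℝ≥0∞) : ℕ → X → X → ℝ≥0∞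
  | 0 => fun x y => Set.indicator {x} (fun _ => 1) y
  | n + 1 => fun x y => ∑' z, K x z * kernelPow K n z y

/-- The spectral radius `limsup_n (Kⁿ(x, y))^{1/n}` of a non-negative kernel, read off at the
pair `(x, y)` (for an irreducible kernel the value does not depend on this pair). -/
def kernelSpectralRadius {X : Type*} (K : X → X → ℝ≥0∞) (x y : X) : ℝ≥0∞ :=
  limsup (fun n : ℕ => kernelPow K n x y ^ (1 / (n : ℝ))) atTop

section Group

variable {G : Type*} [Group G]

/-- `μ` is symmetric: `μ(g⁻¹) = μ(g)`. -/
def IsSymmetric (μ : PMF G) : Prop := ∀ g : G, μ g⁻¹ = μ g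

/-- `μ` is finitely supported. -/
def IsFinitelySupported (μ : PMF G) : Prop := μ.support.Finite

/-- `μ` is admissible: its support generates `G` as a semigroup. -/
def IsAdmissible (μ : PMF G) : Prop := Subsemigroup.closure μ.support = ⊤

/-- The transition kernel `P(x, y) = μ(x⁻¹ y)` of the random walk driven by `μ`. -/
def walkKernel (μ : PMF G) (x y : G) : ℝ≥0∞ := μ (x⁻¹ * y)

/-- `R`, the inverse of the spectral radius of the random walk driven by `μ`. -/
def walkR (μ : PMF G) : ℝ≥0∞ := (kernelSpectralRadius (walkKernel μ) 1 1)⁻¹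

/-- `∑_{z₁, …, zₙ ∉ H} μ(x⁻¹z₁) μ(z₁⁻¹z₂) ⋯ μ(zₙ⁻¹y)`: the weight of the paths of `n + 1` steps
from `x` to `y` whose `n` intermediate points all avoid `H`. -/
def avoidingWeight (μ : PMF G) (H : Subgroup G) : ℕ → G → G → ℝ≥0∞
  | 0 => fun x y => walkKernel μ x y
  | n + 1 => fun x y => ∑' z : {z : G // z ∉ H}, walkKernel μ x z * avoidingWeight μ H n z y

/-- The first return kernel `P_{r,H}` to `H` associated with the measure `r μ`. -/
def firstReturnKernel (μ : PMF G) (r : ℝ≥0∞) (H : Subgroup G) (x y : H) : ℝ≥0∞ :=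
  ∑' n : ℕ, r ^ (n + 1) * avoidingWeight μ H n x y

/-- `R_H(r)`, the inverse of the spectral radius of `P_{r,H}`. -/
def returnR (μ : PMF G) (H : Subgroup G) (r : ℝ≥0∞) : ℝ≥0∞ :=
  (kernelSpectralRadius (firstReturnKernel μ r H) 1 1)⁻¹

/-- `μ` is spectrally degenerate along `H`: `R_H(R) = 1`. -/
def IsSpectrallyDegenerateAlong (μ : PMF G) (H : Subgroup G) : Prop :=
  returnR μ H (walkR μ) = 1

/-- `μ` is spectrally non-degenerate with respect to the collection `Ω` of subgroups. -/
def IsSpectrallyNonDegenerate (μ : PMF G) (Ω : Set (Subgroup G)) : Prop :=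
  ∀ H ∈ Ω, ¬ IsSpectrallyDegenerateAlong μ H

end Group

/-- The free product `Γ₁ * Γ₂` is non-elementary: both factors are non-trivial and they are not
both of order two. -/
def IsNonElementaryFreeProduct (Γ₁ Γ₂ : Type*) [Group Γ₁] [Group Γ₂] : Prop :=
  Nontrivial Γ₁ ∧ Nontrivial Γ₂ ∧ ¬ (Nat.card Γ₁ = 2 ∧ Nat.card Γ₂ = 2)

/-- The parabolic subgroups `Γ₁` and `Γ₂` of the free product `Γ₁ * Γ₂`. -/
def freeFactors (Γ₁ Γ₂ : Type*) [Group Γ₁] [Group Γ₂] : Set (Subgroup (Monoid.Coprod Γ₁ Γ₂)) :=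
  {(Monoid.Coprod.inl : Γ₁ →* Monoid.Coprod Γ₁ Γ₂).range,
    (Monoid.Coprod.inr : Γ₂ →* Monoid.Coprod Γ₁ Γ₂).range}

/-- `μ = α₁ μ₁ + α₂ μ₂`, where `μᵢ` is regarded as a measure on the free product. -/
def IsConvexCombination {Γ₁ Γ₂ : Type*} [Group Γ₁] [Group Γ₂] (μ : PMF (Monoid.Coprod Γ₁ Γ₂))
    (α₁ α₂ : ℝ≥0∞) (μ₁ : PMF Γ₁) (μ₂ : PMF Γ₂) : Prop :=
  α₁ + α₂ = 1 ∧ ∀ g : Monoid.Coprod Γ₁ Γ₂,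
    μ g = α₁ * μ₁.map Monoid.Coprod.inl g + α₂ * μ₂.map Monoid.Coprod.inr g

/-- `μ` is adapted to the free product, with finitely supported, admissible and symmetric
probability measures on the two factors. -/
def IsAdapted {Γ₁ Γ₂ : Type*} [Group Γ₁] [Group Γ₂] (μ : PMF (Monoid.Coprod Γ₁ Γ₂)) : Prop :=
  ∃ (α₁ α₂ : ℝ≥0∞) (μ₁ : PMF Γ₁) (μ₂ : PMF Γ₂),
    IsFinitelySupported μ₁ ∧ IsAdmissible μ₁ ∧ IsSymmetric μ₁ ∧
    IsFinitelySupported μ₂ ∧ IsAdmissible μ₂ ∧ IsSymmetric μ₂ ∧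
    IsConvexCombination μ α₁ α₂ μ₁ μ₂

end RatioLimit

end

/-!
Let `μᵢ` be a symmetric measure on `Γᵢ` and let `Fᵢ` be its Green function at a parameter `zᵢ < 1`,
normalised by `Fᵢ 1 = 1`; it is `zᵢ⁻¹`-harmonic off the identity. For suitable `αᵢ` and `r`, the
product of the values of the `Fᵢ` at the letters of a reduced word is a function `h` on `Γ₁ * Γ₂`
which is `r⁻¹`-harmonic off the identity for `μ = α₁ μ₁ + α₂ μ₂`. Put `Aᵢ = ∑_{a ≠ 1} Fᵢ a ^ 2`. If
`A₁ A₂ = 1`, the sums of `h ^ 2` over the spheres of the word length are bounded while its total sum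
is infinite, so that the truncations of `h` to balls are test functions showing that the spectral
radius of `μ` is at least `r⁻¹`, that is, `R ≤ r`.

On the other hand, let `φ` be the same product with the first letter left out when it lies in `Γᵢ`.
Then `φ` is `1` on `Γᵢ` and `r⁻¹`-harmonic off `Γᵢ`, and its mean after one step from a point of
`Γᵢ` is a constant less than `r⁻¹`, because `zᵢ < 1`. Hence the rows of the first return kernel
`P_{R,Γᵢ}` have sums bounded by a constant less than `1`, and `R_{Γᵢ}(R) > 1`.

As `Aᵢ` is continuous in `zᵢ` and vanishes at `0`, the equation `A₁ A₂ = 1` can be solved once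
`A₁ A₂ ≥ 1` somewhere. Concentrating `μᵢ` on an inverse-closed set `Tᵢ` of at most two non-trivial
elements and letting `zᵢ` tend to `1` makes `Fᵢ` close to `1` on `Tᵢ`, and `|T₁| |T₂| ≥ 2` is
possible because the free product is non-elementary.
-/

noncomputable section

namespace RatioLimit

section ENNReal

theorem tsum_mul_sq_le_sq_mul_sq {X : Type*} (f g : X → ℝ≥0∞) :
    (∑' x, f x * g x) ^ 2 ≤ (∑' x, f x ^ 2) * ∑' x, g x ^ 2 := by
  let _ : MeasurableSpace X := ⊤
  have holder := ENNReal.lintegral_mul_le_Lp_mul_Lq MeasureTheory.Measure.count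
    Real.HolderConjugate.two_two (measurable_from_top (f := f)).aemeasurable
    (measurable_from_top (f := g)).aemeasurable
  simp only [Pi.mul_apply, MeasureTheory.lintegral_count, ENNReal.rpow_ofNat] at holder
  calc (∑' x, f x * g x) ^ 2
      ≤ ((∑' x, f x ^ 2) ^ (1 / 2 : ℝ) * (∑' x, g x ^ 2) ^ (1 / 2 : ℝ)) ^ 2 := by gcongr
    _ = (∑' x, f x ^ 2) * ∑' x, g x ^ 2 := by
        rw [mul_pow, ← ENNReal.rpow_mul_natCast, ← ENNReal.rpow_mul_natCast]
        norm_num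

theorem tsum_sq_le_sq_tsum {X : Type*} (f : X → ℝ≥0∞) : ∑' x, f x ^ 2 ≤ (∑' x, f x) ^ 2 := by
  simp_rw [sq, ← ENNReal.tsum_mul_right]
  gcongr with x
  exact ENNReal.le_tsum x

theorem le_limsup_rpow_of_frequently_pow_le {a C : ℝ≥0∞} (hC : C ≠ ∞) {b : ℕ → ℝ≥0∞}
    (hab : ∃ᶠ n in atTop, a ^ n ≤ C * b n) :
    a ≤ limsup (fun n => b n ^ (1 / (n : ℝ))) atTop := by
  by_contra! hlt
  obtain ⟨q, hbq, hqa⟩ := exists_between hlt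
  have hq₀ : q ≠ 0 := hbq.ne_bot
  have hq : q ≠ ∞ := hqa.ne_top
  have hdiv : 1 < a / q := by
    rwa [ENNReal.lt_div_iff_mul_lt (.inl hq₀) (.inl hq), one_mul]
  have hlarge : ∀ᶠ n in atTop, C < (a / q) ^ n :=
    (ENNReal.tendsto_pow_atTop_nhds_top_iff.2 hdiv).eventually_const_lt hC.lt_top
  obtain ⟨n, habn, hbn, hn, hCn⟩ := (hab.and_eventually ((eventually_lt_of_limsup_lt hbq).and
    ((eventually_ne_atTop 0).and hlarge))).exists
  have hbn' : b n ≤ q ^ n := by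
    rw [← ENNReal.rpow_inv_natCast_pow hn (b n), ← one_div]
    gcongr
  refine hCn.not_ge ?_
  rw [ENNReal.div_eq_inv_mul, mul_pow, ← ENNReal.inv_pow, ← ENNReal.div_eq_inv_mul]
  exact ENNReal.div_le_of_le_mul (habn.trans (by gcongr))

theorem continuousOn_tsum_of_le {ι X : Type*} [TopologicalSpace X] {s : Set X}
    {f : ι → X → ℝ≥0∞} {b : ι → ℝ≥0∞} (hf : ∀ i, ContinuousOn (f i) s)
    (hb : ∑' i, b i ≠ ∞) (hfb : ∀ i, ∀ x ∈ s, f i x ≤ b i) :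
    ContinuousOn (fun x => ∑' i, f i x) s := by
  have hb_top : ∀ i, b i ≠ ∞ := ENNReal.ne_top_of_tsum_ne_top hb
  have hf_top : ∀ i, ∀ x ∈ s, f i x ≠ ∞ := fun i x hx => ne_top_of_le_ne_top (hb_top i) (hfb i x hx)
  have hreal : ContinuousOn (fun x => ∑' i, (f i x).toReal) s := by
    refine continuousOn_tsum (fun i => ENNReal.continuousOn_toReal.comp (hf i) (hf_top i))
      (ENNReal.summable_toReal hb) fun i x hx => ?_
    rw [Real.norm_of_nonneg ENNReal.toReal_nonneg]
    exact ENNReal.toReal_mono (hb_top i) (hfb i x hx)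
  refine (ENNReal.continuous_ofReal.comp_continuousOn hreal).congr fun x hx => ?_
  have hsum : ∑' i, f i x ≠ ∞ :=
    ne_top_of_le_ne_top hb (ENNReal.tsum_le_tsum fun i => hfb i x hx)
  rw [Function.comp_apply, ← ENNReal.tsum_toReal_eq (hf_top · x hx), ENNReal.ofReal_toReal hsum]

end ENNReal

section Kernel

variable {X : Type*} {K : X → X → ℝ≥0∞}

theorem tsum_kernelPow_zero_mul (K : X → X → ℝ≥0∞) (x : X) (f : X → ℝ≥0∞) :
    ∑' y, kernelPow K 0 x y * f y = f x := by
  rw [tsum_eq_single x fun y hy => by simp [kernelPow, hy]]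
  simp [kernelPow]

theorem kernelPow_add (K : X → X → ℝ≥0∞) (m n : ℕ) (x y : X) :
    kernelPow K (m + n) x y = ∑' z, kernelPow K m x z * kernelPow K n z y := by
  induction m generalizing x with
  | zero => rw [tsum_kernelPow_zero_mul, Nat.zero_add]
  | succ m ih =>
    simp only [Nat.succ_add, kernelPow, ih, ← ENNReal.tsum_mul_left, ← ENNReal.tsum_mul_right]
    rw [ENNReal.tsum_comm]
    simp only [mul_assoc]

theorem kernelPow_one (K : X → X → ℝ≥0∞) (x y : X) : kernelPow K 1 x y = K x y := by
  simp only [kernelPow]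
  rw [tsum_eq_single y fun z hz => by simp [hz.symm]]
  simp

theorem kernelPow_succ_right (K : X → X → ℝ≥0∞) (n : ℕ) (x y : X) :
    kernelPow K (n + 1) x y = ∑' z, kernelPow K n x z * K z y := by
  simp_rw [kernelPow_add K n 1 x y, kernelPow_one]

theorem kernelPow_symm (hK : ∀ x y, K x y = K y x) (n : ℕ) (x y : X) :
    kernelPow K n x y = kernelPow K n y x := by
  induction n generalizing x y with
  | zero =>
    by_cases h : x = y
    · rw [h]
    · simp [kernelPow, h, Ne.symm h]
  | succ n ih =>
    rw [kernelPow_succ_right, kernelPow]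
    exact tsum_congr fun z => by rw [ih x z, hK z y, mul_comm]

theorem tsum_kernelPow_le {m : ℝ≥0∞} (hK : ∀ x, ∑' y, K x y ≤ m) (n : ℕ) (x : X) :
    ∑' y, kernelPow K n x y ≤ m ^ n := by
  induction n generalizing x with
  | zero => simpa using (tsum_kernelPow_zero_mul K x 1).le
  | succ n ih =>
    calc ∑' y, kernelPow K (n + 1) x y = ∑' z, K x z * ∑' y, kernelPow K n z y := by
          simp only [kernelPow, ← ENNReal.tsum_mul_left]
          exact ENNReal.tsum_comm
      _ ≤ ∑' z, K x z * m ^ n := by gcongr with z; exact ih z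
      _ ≤ m * m ^ n := by rw [ENNReal.tsum_mul_right]; gcongr; exact hK x
      _ = m ^ (n + 1) := (pow_succ' m n).symm

theorem kernelSpectralRadius_le {m : ℝ≥0∞} (hK : ∀ x, ∑' y, K x y ≤ m) (x y : X) :
    kernelSpectralRadius K x y ≤ m := by
  refine limsup_le_of_le (by isBoundedDefault) ?_
  filter_upwards [eventually_ne_atTop 0] with n hn
  rw [← ENNReal.pow_rpow_inv_natCast hn m, ← one_div]
  gcongr
  exact (ENNReal.le_tsum y).trans (tsum_kernelPow_le hK n x)

/-- The quadratic form `⟨f, Kⁿ f⟩` of the `n`-th power of a kernel. -/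
def quadForm (K : X → X → ℝ≥0∞) (f : X → ℝ≥0∞) (n : ℕ) : ℝ≥0∞ :=
  ∑' x, f x * ∑' y, kernelPow K n x y * f y

theorem quadForm_zero (K : X → X → ℝ≥0∞) (f : X → ℝ≥0∞) : quadForm K f 0 = ∑' x, f x ^ 2 := by
  simp_rw [quadForm, tsum_kernelPow_zero_mul, sq]

theorem quadForm_add_self (hK : ∀ x y, K x y = K y x) (f : X → ℝ≥0∞) (n : ℕ) :
    quadForm K f (n + n) = ∑' z, (∑' y, kernelPow K n z y * f y) ^ 2 := by
  calc quadForm K f (n + n)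
      = ∑' x, ∑' z, f x * (kernelPow K n x z * ∑' y, kernelPow K n z y * f y) := by
        simp_rw [quadForm, kernelPow_add, ← ENNReal.tsum_mul_left, ← ENNReal.tsum_mul_right,
          ← ENNReal.tsum_mul_left, mul_assoc]
        exact tsum_congr fun x => ENNReal.tsum_comm
    _ = ∑' z, ∑' x, kernelPow K n z x * f x * ∑' y, kernelPow K n z y * f y := by
        rw [ENNReal.tsum_comm]
        exact tsum_congr fun z => tsum_congr fun x => by rw [kernelPow_symm hK n x z]; ring
    _ = ∑' z, (∑' y, kernelPow K n z y * f y) ^ 2 := by simp_rw [ENNReal.tsum_mul_right, sq]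

theorem quadForm_sq_le (hK : ∀ x y, K x y = K y x) (f : X → ℝ≥0∞) (n : ℕ) :
    quadForm K f n ^ 2 ≤ quadForm K f 0 * quadForm K f (n + n) := by
  rw [quadForm_add_self hK, quadForm_zero]
  exact tsum_mul_sq_le_sq_mul_sq _ _

theorem quadForm_div_sq_le (hK : ∀ x y, K x y = K y x) (f : X → ℝ≥0∞) (n : ℕ) :
    (quadForm K f n / quadForm K f 0) ^ 2 ≤ quadForm K f (n + n) / quadForm K f 0 := by
  calc (quadForm K f n / quadForm K f 0) ^ 2
      = quadForm K f n ^ 2 * ((quadForm K f 0)⁻¹ * (quadForm K f 0)⁻¹) := by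
        rw [div_eq_mul_inv, mul_pow, sq (_⁻¹)]
    _ ≤ quadForm K f 0 * quadForm K f (n + n) * ((quadForm K f 0)⁻¹ * (quadForm K f 0)⁻¹) := by
        gcongr
        exact quadForm_sq_le hK f n
    _ = quadForm K f 0 * (quadForm K f 0)⁻¹ * (quadForm K f (n + n) / quadForm K f 0) := by
        rw [div_eq_mul_inv]; ring
    _ ≤ quadForm K f (n + n) / quadForm K f 0 := mul_le_of_le_one_left' (ENNReal.mul_inv_le_one _)

theorem quadForm_one_div_pow_le (hK : ∀ x y, K x y = K y x) (f : X → ℝ≥0∞) (j : ℕ) :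
    (quadForm K f 1 / quadForm K f 0) ^ 2 ^ j ≤ quadForm K f (2 ^ j) / quadForm K f 0 := by
  induction j with
  | zero => simp
  | succ j ih =>
    rw [pow_succ, pow_mul, mul_two]
    exact (pow_le_pow_left' ih 2).trans (quadForm_div_sq_le hK f (2 ^ j))

theorem kernelPow_add_self_le (hK : ∀ x y, K x y = K y x) {x₀ : X} {n : ℕ}
    (hmax : ∀ x, kernelPow K (n + n) x x ≤ kernelPow K (n + n) x₀ x₀) (x y : X) :
    kernelPow K (n + n) x y ≤ kernelPow K (n + n) x₀ x₀ := by
  have diagonal : ∀ x, ∑' z, kernelPow K n x z ^ 2 = kernelPow K (n + n) x x := fun x => by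
    rw [kernelPow_add]
    exact tsum_congr fun z => by rw [kernelPow_symm hK n z x, sq]
  refine (ENNReal.pow_le_pow_left_iff two_ne_zero).1 ?_
  calc kernelPow K (n + n) x y ^ 2
      = (∑' z, kernelPow K n x z * kernelPow K n y z) ^ 2 := by
        simp_rw [kernelPow_add, kernelPow_symm hK n y]
    _ ≤ (∑' z, kernelPow K n x z ^ 2) * ∑' z, kernelPow K n y z ^ 2 :=
        tsum_mul_sq_le_sq_mul_sq _ _
    _ ≤ kernelPow K (n + n) x₀ x₀ ^ 2 := by
        rw [diagonal, diagonal, sq]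
        gcongr <;> exact hmax _

theorem quadForm_add_self_le (hK : ∀ x y, K x y = K y x) {x₀ : X} {n : ℕ}
    (hmax : ∀ x, kernelPow K (n + n) x x ≤ kernelPow K (n + n) x₀ x₀) (f : X → ℝ≥0∞) :
    quadForm K f (n + n) ≤ (∑' x, f x) ^ 2 * kernelPow K (n + n) x₀ x₀ := by
  calc quadForm K f (n + n) ≤ ∑' x, f x * ∑' y, kernelPow K (n + n) x₀ x₀ * f y := by
        rw [quadForm]
        gcongr
        exact kernelPow_add_self_le hK hmax _ _
    _ = (∑' x, f x) ^ 2 * kernelPow K (n + n) x₀ x₀ := by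
        rw [ENNReal.tsum_mul_left, ENNReal.tsum_mul_right]; ring

theorem quadForm_one_le (hK : ∀ x y, K x y = K y x) {x₀ : X}
    (hmax : ∀ n x, kernelPow K n x x ≤ kernelPow K n x₀ x₀) {f : X → ℝ≥0∞} (hf : ∑' x, f x ≠ ∞) :
    quadForm K f 1 ≤ quadForm K f 0 * kernelSpectralRadius K x₀ x₀ := by
  have hQ_top : quadForm K f 0 ≠ ∞ := by
    rw [quadForm_zero]
    exact ne_top_of_le_ne_top (ENNReal.pow_ne_top hf) (tsum_sq_le_sq_tsum f)
  rcases eq_or_ne (quadForm K f 0) 0 with hQ | hQ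
  · have h := quadForm_sq_le hK f 1
    rw [hQ, zero_mul, le_zero_iff, pow_eq_zero_iff two_ne_zero] at h
    simp [h]
  rw [mul_comm, ← ENNReal.div_le_iff hQ hQ_top]
  refine le_limsup_rpow_of_frequently_pow_le (C := (∑' x, f x) ^ 2 / quadForm K f 0)
    (ENNReal.div_ne_top (ENNReal.pow_ne_top hf) hQ) ?_
  have along : Tendsto (fun j : ℕ => 2 ^ (j + 1)) atTop atTop :=
    (tendsto_pow_atTop_atTop_of_one_lt one_lt_two).comp (tendsto_add_atTop_nat 1)
  refine along.frequently (.of_forall fun j => ?_)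
  calc (quadForm K f 1 / quadForm K f 0) ^ 2 ^ (j + 1)
      ≤ quadForm K f (2 ^ (j + 1)) / quadForm K f 0 := quadForm_one_div_pow_le hK f (j + 1)
    _ ≤ (∑' x, f x) ^ 2 * kernelPow K (2 ^ (j + 1)) x₀ x₀ / quadForm K f 0 := by
        gcongr
        rw [pow_succ, mul_two]
        exact quadForm_add_self_le hK (hmax _) f
    _ = (∑' x, f x) ^ 2 / quadForm K f 0 * kernelPow K (2 ^ (j + 1)) x₀ x₀ :=
        ENNReal.mul_div_right_comm

end Kernel

section Walk

variable {G : Type*} [Group G] {μ : PMF G}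

theorem tsum_walkKernel_mul (μ : PMF G) (f : G → ℝ≥0∞) (x : G) :
    ∑' y, walkKernel μ x y * f y = ∑' g, μ g * f (x * g) := by
  rw [← (Equiv.mulLeft x).tsum_eq]
  simp [walkKernel]

theorem walkKernel_symm (hμ : IsSymmetric μ) (x y : G) : walkKernel μ x y = walkKernel μ y x := by
  rw [walkKernel, walkKernel, ← hμ]; simp

theorem kernelPow_walkKernel_mul_left (μ : PMF G) (n : ℕ) (g x y : G) :
    kernelPow (walkKernel μ) n (g * x) (g * y) = kernelPow (walkKernel μ) n x y := by
  induction n generalizing x y with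
  | zero => by_cases h : y = x <;> simp [kernelPow, h]
  | succ n ih =>
    simp only [kernelPow]
    rw [← (Equiv.mulLeft g).tsum_eq]
    refine tsum_congr fun z => ?_
    rw [Equiv.coe_mulLeft, ih]
    simp [walkKernel, mul_assoc]

theorem tsum_mul_walk_le (hμ : IsSymmetric μ) {f : G → ℝ≥0∞} (hf : ∑' x, f x ≠ ∞) :
    ∑' x, f x * ∑' g, μ g * f (x * g) ≤
      (∑' x, f x ^ 2) * kernelSpectralRadius (walkKernel μ) 1 1 := by
  have h := quadForm_one_le (walkKernel_symm hμ) (x₀ := 1)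
    (fun n x => by simpa using (kernelPow_walkKernel_mul_left μ n x 1 1).le) hf
  rw [quadForm_zero] at h
  simpa only [quadForm, kernelPow_one, tsum_walkKernel_mul] using h

theorem walkR_le_of_test_functions (hμ : IsSymmetric μ) {r C : ℝ≥0∞} (hC : C ≠ ∞)
    (f : ℕ → G → ℝ≥0∞) (hf : ∀ N, ∑' x, f N x ≠ ∞)
    (hle : ∀ N, ∑' x, f N x ^ 2 ≤ r * ∑' x, f N x * ∑' g, μ g * f N (x * g) + C)
    (hlim : Tendsto (fun N => ∑' x, f N x ^ 2) atTop (nhds ∞)) : walkR μ ≤ r := by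
  set ρ := kernelSpectralRadius (walkKernel μ) 1 1 with hρ
  suffices h : 1 ≤ r * ρ by
    rw [walkR, ← hρ, ← one_div]
    exact ENNReal.div_le_of_le_mul h
  by_contra! hlt
  have hgap : 1 - r * ρ ≠ 0 := (tsub_pos_of_lt hlt).ne'
  have bound : ∀ N, ∑' x, f N x ^ 2 ≤ C / (1 - r * ρ) := fun N => by
    have hfin : ∑' x, f N x ^ 2 ≠ ∞ :=
      ne_top_of_le_ne_top (ENNReal.pow_ne_top (hf N)) (tsum_sq_le_sq_tsum _)
    rw [ENNReal.le_div_iff_mul_le (.inl hgap) (.inl (by finiteness)),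
      ENNReal.mul_sub fun _ _ => hfin, mul_one, tsub_le_iff_left]
    calc ∑' x, f N x ^ 2 ≤ r * ∑' x, f N x * ∑' g, μ g * f N (x * g) + C := hle N
      _ ≤ r * ((∑' x, f N x ^ 2) * ρ) + C := by gcongr; exact tsum_mul_walk_le hμ (hf N)
      _ = (∑' x, f N x ^ 2) * (r * ρ) + C := by ring
  obtain ⟨N, hN⟩ := (hlim.eventually_const_lt (ENNReal.div_lt_top hC hgap)).exists
  exact (bound N).not_gt hN

theorem tsum_avoidingWeight_succ (μ : PMF G) (H : Subgroup G) (n : ℕ) (x : G) :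
    ∑' y : H, avoidingWeight μ H (n + 1) x y =
      ∑' z : {z : G // z ∉ H}, walkKernel μ x z * ∑' y : H, avoidingWeight μ H n z y := by
  simp_rw [avoidingWeight, ← ENNReal.tsum_mul_left]
  exact ENNReal.tsum_comm

theorem sum_range_avoidingWeight_le {H : Subgroup G} {r : ℝ≥0∞} {φ : G → ℝ≥0∞}
    (hφ : ∀ x ∈ H, φ x = 1) (hoff : ∀ x ∉ H, r * ∑' g, μ g * φ (x * g) ≤ φ x) (N : ℕ) (x : G) :
    ∑ n ∈ Finset.range N, r ^ (n + 1) * ∑' y : H, avoidingWeight μ H n x y ≤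
      r * ∑' g, μ g * φ (x * g) := by
  induction N generalizing x with
  | zero => simp
  | succ N ih =>
    have later : ∑ n ∈ Finset.range N, r ^ (n + 1) * ∑' y : H, avoidingWeight μ H (n + 1) x y ≤
        ∑' z : {z : G // z ∉ H}, walkKernel μ x z * φ z := by
      calc ∑ n ∈ Finset.range N, r ^ (n + 1) * ∑' y : H, avoidingWeight μ H (n + 1) x y
          = ∑' z : {z : G // z ∉ H}, walkKernel μ x z *
              ∑ n ∈ Finset.range N, r ^ (n + 1) * ∑' y : H, avoidingWeight μ H n z y := by
            simp_rw [tsum_avoidingWeight_succ, Finset.mul_sum]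
            rw [Summable.tsum_finsetSum fun _ _ => ENNReal.summable]
            refine Finset.sum_congr rfl fun n _ => ?_
            rw [← ENNReal.tsum_mul_left]
            exact tsum_congr fun z => mul_left_comm _ _ _
        _ ≤ ∑' z : {z : G // z ∉ H}, walkKernel μ x z * φ z := by
            gcongr with z
            exact (ih z).trans (hoff z z.2)
    have first : ∑' y : H, avoidingWeight μ H 0 x y = ∑' y : H, walkKernel μ x y * φ y :=
      tsum_congr fun y => by rw [hφ y y.2, mul_one, avoidingWeight]
    calc ∑ n ∈ Finset.range (N + 1), r ^ (n + 1) * ∑' y : H, avoidingWeight μ H n x y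
        = r * (∑' y : H, walkKernel μ x y * φ y +
            ∑ n ∈ Finset.range N, r ^ (n + 1) * ∑' y : H, avoidingWeight μ H (n + 1) x y) := by
          rw [Finset.sum_range_succ', first, add_comm, mul_add, Finset.mul_sum]
          simp only [zero_add, pow_one, pow_succ' r (_ + 1), mul_assoc]
      _ ≤ r * (∑' y : H, walkKernel μ x y * φ y +
            ∑' z : {z : G // z ∉ H}, walkKernel μ x z * φ z) := by gcongr
      _ = r * ∑' g, μ g * φ (x * g) := by
          rw [← tsum_walkKernel_mul]
          congr 1
          exact ENNReal.summable.tsum_add_tsum_compl (s := (H : Set G))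
            (f := fun y => walkKernel μ x y * φ y) ENNReal.summable

theorem not_isSpectrallyDegenerateAlong {H : Subgroup G} {r m : ℝ≥0∞} (hR : walkR μ ≤ r)
    (hm : m < 1) {φ : G → ℝ≥0∞} (hφ : ∀ x ∈ H, φ x = 1)
    (hoff : ∀ x ∉ H, r * ∑' g, μ g * φ (x * g) ≤ φ x)
    (hon : ∀ x ∈ H, r * ∑' g, μ g * φ (x * g) ≤ m) : ¬ IsSpectrallyDegenerateAlong μ H := by
  have mass : ∀ x : H, ∑' y, firstReturnKernel μ (walkR μ) H x y ≤ m := fun x => by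
    simp_rw [firstReturnKernel]
    rw [ENNReal.tsum_comm]
    simp_rw [ENNReal.tsum_mul_left]
    rw [ENNReal.tsum_eq_iSup_nat]
    refine iSup_le fun N => ?_
    calc ∑ n ∈ Finset.range N, walkR μ ^ (n + 1) * ∑' y : H, avoidingWeight μ H n x y
        ≤ ∑ n ∈ Finset.range N, r ^ (n + 1) * ∑' y : H, avoidingWeight μ H n x y := by gcongr
      _ ≤ r * ∑' g, μ g * φ (x * g) := sum_range_avoidingWeight_le hφ hoff N x
      _ ≤ m := hon x x.2
  rw [IsSpectrallyDegenerateAlong, returnR, ENNReal.inv_eq_one]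
  exact ((kernelSpectralRadius_le mass 1 1).trans_lt hm).ne

end Walk

section PMF

variable {ι X Y A B : Type*} [Group A] [Group B]

theorem tsum_pure_mul (x : X) (k : X → ℝ≥0∞) : ∑' y, PMF.pure x y * k y = k x := by
  rw [tsum_eq_single x fun y hy => by simp [PMF.pure_apply, hy]]
  simp

theorem tsum_bind_mul (p : PMF ι) (f : ι → PMF X) (k : X → ℝ≥0∞) :
    ∑' x, p.bind f x * k x = ∑' i, p i * ∑' x, f i x * k x := by
  simp_rw [PMF.bind_apply, ← ENNReal.tsum_mul_left, ← ENNReal.tsum_mul_right, mul_assoc]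
  exact ENNReal.tsum_comm

theorem tsum_map_mul (p : PMF ι) (f : ι → X) (k : X → ℝ≥0∞) :
    ∑' x, p.map f x * k x = ∑' i, p i * k (f i) := by
  simp_rw [PMF.map, tsum_bind_mul, Function.comp_apply, tsum_pure_mul]

theorem IsSymmetric.map {p : PMF A} (hp : IsSymmetric p) (f : A →* B) : IsSymmetric (p.map f) := by
  intro b
  rw [PMF.map_apply, PMF.map_apply, ← (Equiv.inv A).tsum_eq]
  exact tsum_congr fun a => by rw [Equiv.inv_apply, hp, map_inv, inv_inj]

theorem IsSymmetric.bind {p : PMF ι} {f : ι → PMF A} (hf : ∀ i, IsSymmetric (f i)) :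
    IsSymmetric (p.bind f) := by
  intro a
  simp_rw [PMF.bind_apply, hf _ a]

theorem IsFinitelySupported.map {p : PMF X} (hp : IsFinitelySupported p) (f : X → Y) :
    IsFinitelySupported (p.map f) := by
  rw [IsFinitelySupported, PMF.support_map]
  exact Set.Finite.image f hp

theorem IsFinitelySupported.bind {p : PMF ι} (hp : p.support.Finite) {f : ι → PMF X}
    (hf : ∀ i, IsFinitelySupported (f i)) : IsFinitelySupported (p.bind f) := by
  rw [IsFinitelySupported, PMF.support_bind]
  exact hp.biUnion fun i _ => hf i

theorem IsAdmissible.map {p : PMF A} (hp : IsAdmissible p) {f : A →* B}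
    (hf : Function.Surjective f) : IsAdmissible (p.map f) := by
  rw [IsAdmissible, PMF.support_map, eq_top_iff]
  have himage := MulHom.map_mclosure (f : A →ₙ* B) p.support
  rw [show Subsemigroup.closure p.support = ⊤ from hp] at himage
  rintro b -
  obtain ⟨a, rfl⟩ := hf b
  exact himage.le ⟨a, trivial, rfl⟩

theorem IsAdmissible.bind {p : PMF ι} {f : ι → PMF A} {i : ι} (hi : p i ≠ 0)
    (hf : IsAdmissible (f i)) : IsAdmissible (p.bind f) := by
  rw [IsAdmissible, eq_top_iff, ← hf, PMF.support_bind]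
  exact Subsemigroup.closure_mono
    (Set.subset_biUnion_of_mem (u := fun i => (f i).support) ((p.mem_support_iff i).2 hi))

theorem isSymmetric_uniformOfFinset {T : Finset A} (hT : T.Nonempty) (hinv : ∀ a ∈ T, a⁻¹ ∈ T) :
    IsSymmetric (PMF.uniformOfFinset T hT) := by
  intro a
  have hiff : a⁻¹ ∈ T ↔ a ∈ T := ⟨fun h => by simpa using hinv _ h, hinv a⟩
  by_cases ha : a ∈ T <;> simp [hiff, ha]

theorem isFinitelySupported_uniformOfFinset {T : Finset X} (hT : T.Nonempty) :
    IsFinitelySupported (PMF.uniformOfFinset T hT) := by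
  rw [IsFinitelySupported, PMF.support_uniformOfFinset]
  exact T.finite_toSet

theorem subsemigroup_closure_eq_top {S T : Set A} (hS : Subgroup.closure S = ⊤)
    (hone : 1 ∈ T) (hsub : S ⊆ T) (hinv : ∀ a ∈ T, a⁻¹ ∈ T) : Subsemigroup.closure T = ⊤ := by
  rw [eq_top_iff]
  rintro a -
  have ha : a ∈ Submonoid.closure (S ∪ S⁻¹) := by
    rw [← Subgroup.closure_toSubmonoid, hS]; trivial
  induction ha using Submonoid.closure_induction with
  | mem b hb =>
    refine Subsemigroup.subset_closure (hb.elim (fun hb => hsub hb) fun hb => ?_)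
    simpa using hinv _ (hsub hb)
  | one => exact Subsemigroup.subset_closure hone
  | mul b c _ _ hb hc => exact mul_mem hb hc

theorem exists_symmetric_admissible (A : Type*) [Group A] [Group.FG A] :
    ∃ κ : PMF A, IsFinitelySupported κ ∧ IsSymmetric κ ∧ IsAdmissible κ := by
  classical
  obtain ⟨S, hS⟩ := Group.fg_def.1 (inferInstance : Group.FG A)
  set T : Finset A := insert 1 (S ∪ S.image (·⁻¹)) with hT
  have hone : 1 ∈ T := by simp [hT]
  have hinv : ∀ a ∈ T, a⁻¹ ∈ T := by
    intro a ha
    simp only [hT, Finset.mem_insert, Finset.mem_union, Finset.mem_image] at ha ⊢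
    rcases ha with rfl | ha | ⟨b, hb, rfl⟩
    · simp
    · exact .inr (.inr ⟨a, ha, rfl⟩)
    · simp [hb]
  have hT_ne : T.Nonempty := ⟨1, hone⟩
  refine ⟨PMF.uniformOfFinset T hT_ne, isFinitelySupported_uniformOfFinset _,
    isSymmetric_uniformOfFinset _ hinv, ?_⟩
  rw [IsAdmissible, PMF.support_uniformOfFinset]
  exact subsemigroup_closure_eq_top hS hone (fun a ha => by simp [hT, Finset.mem_coe.1 ha]) hinv

theorem exists_symmetric_admissible_le [Group.FG A] {T : Finset A} (hT : T.Nonempty)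
    (hinv : ∀ a ∈ T, a⁻¹ ∈ T) {u : ℝ≥0∞} (hu : u < 1) :
    ∃ μ : PMF A, IsFinitelySupported μ ∧ IsSymmetric μ ∧ IsAdmissible μ ∧
      ∀ a ∈ T, u ≤ T.card * μ a := by
  obtain ⟨κ, hκ_fin, hκ_symm, hκ_adm⟩ := exists_symmetric_admissible A
  let coin : PMF Bool := PMF.ofFintype (cond · u (1 - u)) (by simp [add_tsub_cancel_of_le hu.le])
  let part : Bool → PMF A := (cond · (PMF.uniformOfFinset T hT) κ)
  refine ⟨coin.bind part, .bind (Set.toFinite _) ?_, .bind ?_, .bind (i := false) ?_ hκ_adm, ?_⟩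
  · exact Bool.forall_bool.2 ⟨hκ_fin, isFinitelySupported_uniformOfFinset hT⟩
  · exact Bool.forall_bool.2 ⟨hκ_symm, isSymmetric_uniformOfFinset hT hinv⟩
  · simpa [coin] using (tsub_pos_of_lt hu).ne'
  · intro a ha
    have hcard : (T.card : ℝ≥0∞) ≠ 0 := by simpa using hT.ne_empty
    calc u = T.card * (u * (T.card : ℝ≥0∞)⁻¹) := by
          rw [mul_left_comm, ENNReal.mul_inv_cancel hcard (by simp), mul_one]
      _ = T.card * (coin true * part true a) := by
          simp [coin, part, ha]
      _ ≤ T.card * coin.bind part a := by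
          rw [PMF.bind_apply]
          gcongr
          exact ENNReal.le_tsum (f := fun i => coin i * part i a) true

end PMF

section Green

variable {A : Type*} [Group A] {μ : PMF A} {z : ℝ≥0∞}

/-- The Green function `∑ₙ zⁿ Pⁿ(x, 1)` of the random walk driven by `μ`. -/
def green (μ : PMF A) (z : ℝ≥0∞) (x : A) : ℝ≥0∞ :=
  ∑' n : ℕ, z ^ n * kernelPow (walkKernel μ) n x 1

/-- The Green function normalised at the identity. At `x` it is the generating function of the
first hitting time of `1` by the random walk started at `x`. -/
def hitting (μ : PMF A) (z : ℝ≥0∞) (x : A) : ℝ≥0∞ := green μ z x / green μ z 1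

/-- The generating function of the first return time to `1`. -/
def returnGen (μ : PMF A) (z : ℝ≥0∞) : ℝ≥0∞ := z * ∑' y, μ y * hitting μ z y

/-- The square of the `ℓ²`-norm of `hitting μ z` away from the identity. -/
def hittingSqSum (μ : PMF A) (z : ℝ≥0∞) : ℝ≥0∞ := ∑' a : {a : A // a ≠ 1}, hitting μ z a ^ 2

theorem green_eq_indicator_add (μ : PMF A) (z : ℝ≥0∞) (x : A) :
    green μ z x = Set.indicator {x} (fun _ => 1) 1 + z * ∑' y, μ y * green μ z (x * y) := by
  rw [green, tsum_eq_zero_add' ENNReal.summable]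
  congr 1
  · simp [kernelPow]
  · simp only [kernelPow, green, tsum_walkKernel_mul, ← ENNReal.tsum_mul_left]
    rw [ENNReal.tsum_comm]
    exact tsum_congr fun y => tsum_congr fun n => by ring

theorem one_le_green_one (μ : PMF A) (z : ℝ≥0∞) : 1 ≤ green μ z 1 := by
  rw [green_eq_indicator_add]; simp

theorem green_mono (μ : PMF A) (x : A) : Monotone (green μ · x) := fun z w hzw => by
  simp only [green]; gcongr

theorem hitting_le_green (μ : PMF A) (z : ℝ≥0∞) (x : A) : hitting μ z x ≤ green μ z x :=
  ENNReal.div_le_of_le_mul (le_mul_of_one_le_right' (one_le_green_one μ z))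

theorem mul_tsum_mul_hitting (μ : PMF A) (z : ℝ≥0∞) (x : A) :
    z * ∑' y, μ y * hitting μ z (x * y) =
      (z * ∑' y, μ y * green μ z (x * y)) / green μ z 1 := by
  simp only [hitting, div_eq_mul_inv, ← mul_assoc]
  rw [ENNReal.tsum_mul_right, mul_assoc]

theorem hitting_harmonic {x : A} (hx : x ≠ 1) :
    z * ∑' y, μ y * hitting μ z (x * y) = hitting μ z x := by
  rw [mul_tsum_mul_hitting, hitting, green_eq_indicator_add μ z x]
  simp [hx.symm]

theorem returnGen_add_inv_green (hg : green μ z 1 ≠ ∞) :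
    returnGen μ z + (green μ z 1)⁻¹ = 1 := by
  have hgreen := green_eq_indicator_add μ z 1
  have hreturn := mul_tsum_mul_hitting μ z 1
  simp only [one_mul, Set.mem_singleton_iff, Set.indicator_of_mem] at hgreen hreturn
  rw [returnGen, hreturn, ← one_div, ← ENNReal.add_div, add_comm, ← hgreen]
  exact ENNReal.div_self (zero_lt_one.trans_le (one_le_green_one μ z)).ne' hg

theorem le_of_superharmonic_of_subharmonic (hz : z < 1) {f v : A → ℝ≥0∞} {C : ℝ≥0∞} (hC : C ≠ ∞)
    (hv : ∀ x, v x ≤ C) {B : Set A} (hB : ∀ x ∈ B, v x ≤ f x)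
    (hf : ∀ x ∉ B, z * ∑' y, μ y * f (x * y) ≤ f x)
    (hsub : ∀ x ∉ B, v x ≤ z * ∑' y, μ y * v (x * y)) (x : A) : v x ≤ f x := by
  have geometric : ∀ (n : ℕ) (x : A), v x ≤ f x + C * z ^ n := by
    intro n
    induction n with
    | zero => intro x; simpa using (hv x).trans le_add_self
    | succ n ih =>
      intro x
      by_cases hx : x ∈ B
      · exact (hB x hx).trans le_self_add
      calc v x ≤ z * ∑' y, μ y * (f (x * y) + C * z ^ n) := by
            refine (hsub x hx).trans ?_
            gcongr
            exact ih _
        _ = z * ∑' y, μ y * f (x * y) + C * z ^ (n + 1) := by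
            simp_rw [mul_add]
            rw [ENNReal.tsum_add, ENNReal.tsum_mul_right, μ.tsum_coe]
            ring
        _ ≤ f x + C * z ^ (n + 1) := by gcongr; exact hf x hx
  have hlim : Tendsto (fun n : ℕ => f x + C * z ^ n) atTop (nhds (f x + C * 0)) :=
    tendsto_const_nhds.add (ENNReal.Tendsto.const_mul
      (ENNReal.tendsto_pow_atTop_nhds_zero_of_lt_one hz) (.inr hC))
  rw [mul_zero, add_zero] at hlim
  exact ge_of_tendsto' hlim fun n => geometric n x

theorem tsum_kernelPow_walkKernel_le_one (μ : PMF A) (n : ℕ) (x : A) :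
    ∑' y, kernelPow (walkKernel μ) n x y ≤ 1 := by
  have hmass : ∀ x, ∑' y, walkKernel μ x y = 1 := fun x => by
    simpa [μ.tsum_coe] using tsum_walkKernel_mul μ 1 x
  simpa using tsum_kernelPow_le (fun x => (hmass x).le) n x

theorem kernelPow_walkKernel_le_one (μ : PMF A) (n : ℕ) (x y : A) :
    kernelPow (walkKernel μ) n x y ≤ 1 :=
  (ENNReal.le_tsum y).trans (tsum_kernelPow_walkKernel_le_one μ n x)

theorem green_le (μ : PMF A) (z : ℝ≥0∞) (x : A) : green μ z x ≤ (1 - z)⁻¹ := by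
  rw [← ENNReal.tsum_geometric]
  exact ENNReal.tsum_le_tsum fun n =>
    mul_le_of_le_one_right' (kernelPow_walkKernel_le_one μ n x 1)

theorem green_ne_top (μ : PMF A) (hz : z < 1) (x : A) : green μ z x ≠ ∞ :=
  ne_top_of_le_ne_top (ENNReal.inv_ne_top.2 (tsub_pos_of_lt hz).ne') (green_le μ z x)

theorem hitting_one (μ : PMF A) (hz : z < 1) : hitting μ z 1 = 1 :=
  ENNReal.div_self (zero_lt_one.trans_le (one_le_green_one μ z)).ne' (green_ne_top μ hz 1)

theorem hitting_le_one (μ : PMF A) (hz : z < 1) (x : A) : hitting μ z x ≤ 1 := by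
  refine le_of_superharmonic_of_subharmonic (μ := μ) (f := 1) (B := {1}) hz
    (ENNReal.inv_ne_top.2 (tsub_pos_of_lt hz).ne')
    (fun x => (hitting_le_green μ z x).trans (green_le μ z x)) ?_ ?_ ?_ x
  · rintro x rfl; exact (hitting_one μ hz).le
  · intro x _; simp [μ.tsum_coe, hz.le]
  · intro x hx; exact (hitting_harmonic hx).ge

theorem hitting_mul_hitting_le (μ : PMF A) (hz : z < 1) (x y : A) :
    hitting μ z x * hitting μ z y ≤ hitting μ z (x * y) := by
  have hle_one : ∀ w, hitting μ z x * hitting μ z (x⁻¹ * w) ≤ 1 := fun w =>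
    mul_le_one' (hitting_le_one μ hz _) (hitting_le_one μ hz _)
  have h := le_of_superharmonic_of_subharmonic (μ := μ) (f := hitting μ z) (B := {1, x}) hz
    ENNReal.one_ne_top hle_one ?_ ?_ ?_ (x * y)
  · simpa using h
  · rintro w (rfl | rfl)
    · exact (hle_one 1).trans (hitting_one μ hz).ge
    · simp [hitting_one μ hz]
  · intro w hw
    exact (hitting_harmonic fun h => hw (.inl h)).le
  · intro w hw
    have hne : x⁻¹ * w ≠ 1 := fun h => hw (.inr (inv_mul_eq_one.1 h).symm)
    rw [← hitting_harmonic hne, mul_left_comm, ← ENNReal.tsum_mul_left]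
    simp_rw [mul_left_comm (hitting μ z x), mul_assoc]
    exact le_rfl

theorem continuousOn_green (μ : PMF A) {z₀ : ℝ≥0∞} (hz₀ : z₀ < 1) (x : A) :
    ContinuousOn (green μ · x) (Set.Iic z₀) := by
  have hK := fun n => kernelPow_walkKernel_le_one μ n x 1
  refine continuousOn_tsum_of_le (b := fun n => z₀ ^ n) (fun n => ?_) ?_ fun n z hz => ?_
  · exact ((ENNReal.continuous_mul_const (ne_top_of_le_ne_top ENNReal.one_ne_top (hK n))).comp
      (ENNReal.continuous_pow n)).continuousOn
  · rw [ENNReal.tsum_geometric]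
    exact ENNReal.inv_ne_top.2 (tsub_pos_of_lt hz₀).ne'
  · exact mul_le_of_le_of_le_one (pow_le_pow_left' hz n) (hK n)

theorem continuousOn_hitting (μ : PMF A) {z₀ : ℝ≥0∞} (hz₀ : z₀ < 1) (x : A) :
    ContinuousOn (hitting μ · x) (Set.Iic z₀) := by
  simp only [hitting, div_eq_mul_inv]
  refine (continuousOn_green μ hz₀ x).ennreal_mul
    (continuous_inv.comp_continuousOn (continuousOn_green μ hz₀ 1)) (fun z _ => .inr ?_)
    fun z hz => .inr ?_
  · exact ENNReal.inv_ne_top.2 (zero_lt_one.trans_le (one_le_green_one μ z)).ne'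
  · exact green_ne_top μ (lt_of_le_of_lt hz hz₀) x

section Symmetric

variable (hμ : IsSymmetric μ)
include hμ

theorem green_inv (z : ℝ≥0∞) (x : A) : green μ z x⁻¹ = green μ z x := by
  refine tsum_congr fun n => ?_
  rw [← kernelPow_walkKernel_mul_left μ n x x⁻¹ 1, mul_inv_cancel, mul_one,
    kernelPow_symm (walkKernel_symm hμ)]

theorem hitting_inv (z : ℝ≥0∞) (x : A) : hitting μ z x⁻¹ = hitting μ z x := by
  rw [hitting, green_inv hμ, hitting]

theorem hitting_harmonic_left {x : A} (hx : x ≠ 1) :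
    z * ∑' y, μ y * hitting μ z (y * x) = hitting μ z x := by
  rw [← hitting_inv hμ z x, ← hitting_harmonic (inv_ne_one.2 hx),
    ← (Equiv.inv A).tsum_eq fun y => μ y * hitting μ z (x⁻¹ * y)]
  congr 1
  refine tsum_congr fun y => ?_
  rw [Equiv.inv_apply, hμ, ← hitting_inv hμ z (y * x), mul_inv_rev]

variable (hz : z < 1)
include hz

theorem tsum_green_ne_top : ∑' x, green μ z x ≠ ∞ := by
  have hgeom : ∑' x, green μ z x ≤ ∑' n : ℕ, z ^ n := by
    calc ∑' x, green μ z x = ∑' n : ℕ, z ^ n * ∑' x, kernelPow (walkKernel μ) n 1 x := by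
          simp_rw [green, ← ENNReal.tsum_mul_left, kernelPow_symm (walkKernel_symm hμ) _ 1]
          exact ENNReal.tsum_comm
      _ ≤ ∑' n : ℕ, z ^ n := by
          gcongr with n
          exact mul_le_of_le_one_right' (tsum_kernelPow_walkKernel_le_one μ n 1)
  rw [ENNReal.tsum_geometric] at hgeom
  exact ne_top_of_le_ne_top (ENNReal.inv_ne_top.2 (tsub_pos_of_lt hz).ne') hgeom

end Symmetric

end Green

section HittingSqSum

variable {A : Type*} [Group A] {μ : PMF A}

theorem hittingSqSum_zero (μ : PMF A) : hittingSqSum μ 0 = 0 := by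
  refine ENNReal.tsum_eq_zero.2 fun a => ?_
  rw [hitting, green_eq_indicator_add]
  simp [a.2.symm]

theorem hitting_sq_le_green_sq (μ : PMF A) {z z₀ : ℝ≥0∞} (hz : z ≤ z₀) (x : A) :
    hitting μ z x ^ 2 ≤ green μ z₀ x ^ 2 := by
  gcongr
  exact (hitting_le_green μ z x).trans (green_mono μ x hz)

variable (hμ : IsSymmetric μ) {z₀ : ℝ≥0∞} (hz₀ : z₀ < 1)
include hμ hz₀

theorem tsum_green_sq_ne_top : ∑' a : {a : A // a ≠ 1}, green μ z₀ a ^ 2 ≠ ∞ := by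
  refine ne_top_of_le_ne_top (ENNReal.pow_ne_top (n := 2) (tsum_green_ne_top hμ hz₀)) ?_
  refine le_trans ?_ (tsum_sq_le_sq_tsum (green μ z₀))
  exact ENNReal.tsum_comp_le_tsum_of_injective Subtype.val_injective _

theorem hittingSqSum_ne_top : hittingSqSum μ z₀ ≠ ∞ :=
  ne_top_of_le_ne_top (tsum_green_sq_ne_top hμ hz₀)
    (ENNReal.tsum_le_tsum fun a => hitting_sq_le_green_sq μ le_rfl a)

theorem continuousOn_hittingSqSum : ContinuousOn (hittingSqSum μ) (Set.Iic z₀) :=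
  continuousOn_tsum_of_le
    (fun a => (ENNReal.continuous_pow 2).comp_continuousOn (continuousOn_hitting μ hz₀ a))
    (tsum_green_sq_ne_top hμ hz₀) fun a _ hz => hitting_sq_le_green_sq μ hz a

theorem exists_hittingSqSum_eq {s : ℝ≥0∞} (hs : s ≤ hittingSqSum μ z₀) :
    ∃ z ≤ z₀, hittingSqSum μ z = s := by
  have hcont : ContinuousOn (hittingSqSum μ) (Set.Icc 0 z₀) :=
    (continuousOn_hittingSqSum hμ hz₀).mono Set.Icc_subset_Iic_self
  obtain ⟨z, hz, rfl⟩ := intermediate_value_Icc zero_le hcont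
    ⟨(hittingSqSum_zero μ).le.trans zero_le, hs⟩
  exact ⟨z, hz.2, rfl⟩

end HittingSqSum

section Concentration

variable {A : Type*} [Group A] {μ : PMF A} {z : ℝ≥0∞}

theorem mul_sum_hitting_le {T : Finset A} {q : ℝ≥0∞} (hq : ∀ t ∈ T, q ≤ T.card * (z * μ t))
    {s : A} (hs : s ≠ 1) :
    q * ∑ t ∈ T, hitting μ z (s * t) ≤ T.card * hitting μ z s := by
  calc q * ∑ t ∈ T, hitting μ z (s * t)
      = ∑ t ∈ T, q * hitting μ z (s * t) := Finset.mul_sum ..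
    _ ≤ ∑ t ∈ T, T.card * (z * μ t) * hitting μ z (s * t) :=
        Finset.sum_le_sum fun t ht => by gcongr; exact hq t ht
    _ = T.card * (z * ∑ t ∈ T, μ t * hitting μ z (s * t)) := by
        simp_rw [Finset.mul_sum, mul_assoc]
    _ ≤ T.card * (z * ∑' t, μ t * hitting μ z (s * t)) := by
        gcongr
        exact ENNReal.sum_le_tsum T
    _ = T.card * hitting μ z s := by rw [hitting_harmonic hs]

/- The term `t = s⁻¹` of harmonicity at `s` contributes `hitting μ z 1 = 1`, and every other term
at least `hitting μ z s ^ 2`. -/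
theorem mul_one_add_sq_hitting_le (hz : z < 1) {T : Finset A} (hone : (1 : A) ∉ T)
    (hinv : ∀ t ∈ T, t⁻¹ ∈ T) {q : ℝ≥0∞} (hq : ∀ t ∈ T, q ≤ T.card * (z * μ t)) {s : A}
    (hs : s ∈ T) (hmin : ∀ t ∈ T, hitting μ z s ≤ hitting μ z t) :
    q * (1 + (T.card - 1 : ℕ) * hitting μ z s ^ 2) ≤ T.card * hitting μ z s := by
  classical
  refine le_trans ?_ (mul_sum_hitting_le hq fun h => hone (h ▸ hs))
  rw [← Finset.add_sum_erase T _ (hinv s hs), mul_inv_cancel, hitting_one μ hz,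
    ← Finset.card_erase_of_mem (hinv s hs), ← nsmul_eq_mul]
  gcongr
  refine Finset.card_nsmul_le_sum _ _ _ fun t ht => ?_
  calc hitting μ z s ^ 2 = hitting μ z s * hitting μ z s := sq _
    _ ≤ hitting μ z s * hitting μ z t := by
        gcongr
        exact hmin t (Finset.mem_of_mem_erase ht)
    _ ≤ hitting μ z (s * t) := hitting_mul_hitting_le μ hz s t

theorem sq_one_sub_hitting_le (hz : z < 1) {T : Finset A} (hone : (1 : A) ∉ T)
    (hinv : ∀ t ∈ T, t⁻¹ ∈ T) (hcard : T.card ≤ 2) {q : ℝ≥0∞}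
    (hq : ∀ t ∈ T, q ≤ T.card * (z * μ t)) {a : A} (ha : a ∈ T) :
    (1 - (hitting μ z a).toReal) ^ 2 ≤ 2 * (1 - q.toReal) := by
  obtain ⟨s, hs, hmin⟩ := T.exists_min_image (hitting μ z) ⟨a, ha⟩
  have hfin : ∀ x, hitting μ z x ≠ ∞ := fun x =>
    ne_top_of_le_ne_top ENNReal.one_ne_top (hitting_le_one μ hz x)
  have hm_le_a := ENNReal.toReal_mono (hfin a) (hmin a ha)
  have ha_le_one := ENNReal.toReal_mono ENNReal.one_ne_top (hitting_le_one μ hz a)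
  have hharm := ENNReal.toReal_mono (by finiteness [hfin s])
    (mul_one_add_sq_hitting_le hz hone hinv hq hs hmin)
  rw [ENNReal.toReal_mul, ENNReal.toReal_add (by finiteness) (by finiteness [hfin s])] at hharm
  simp only [ENNReal.toReal_mul, ENNReal.toReal_pow, ENNReal.toReal_natCast,
    ENNReal.toReal_one] at hharm ha_le_one
  set m := (hitting μ z s).toReal
  have hm_nonneg : 0 ≤ m := ENNReal.toReal_nonneg
  have hm_le_one : m ≤ 1 := hm_le_a.trans ha_le_one
  have hq_le : q.toReal * (1 + m ^ 2) ≤ 2 * m := by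
    have hpos : 1 ≤ T.card := Finset.card_pos.2 ⟨s, hs⟩
    interval_cases T.card <;> norm_num at hharm
    · nlinarith
    · exact hharm
  have hq_le_one : q.toReal ≤ 1 := by nlinarith [sq_nonneg (1 - m)]
  calc (1 - (hitting μ z a).toReal) ^ 2 ≤ (1 - m) ^ 2 :=
        pow_le_pow_left₀ (sub_nonneg.2 ha_le_one) (sub_le_sub_left hm_le_a 1) 2
    _ ≤ 2 * (1 - q.toReal) := by
        nlinarith [mul_nonneg (sub_nonneg.2 hq_le_one)
          (sub_nonneg.2 (pow_le_one₀ (n := 2) hm_nonneg hm_le_one))]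

theorem exists_symmetric_subset_card_le_two (A : Type*) [Group A] [Nontrivial A] :
    ∃ T : Finset A, T.Nonempty ∧ T.card ≤ 2 ∧ (1 : A) ∉ T ∧ (∀ t ∈ T, t⁻¹ ∈ T) ∧
      (Nat.card A = 2 ∨ T.card = 2) := by
  classical
  by_cases hinvol : ∀ s : A, s⁻¹ = s
  · obtain ⟨s, hs⟩ := exists_ne (1 : A)
    by_cases hcard : Nat.card A = 2
    · exact ⟨{s}, by simp, by simp, by simpa using hs.symm, by simp [hinvol], .inl hcard⟩
    · obtain ⟨t, ht⟩ : ∃ t, t ≠ 1 ∧ t ≠ s := by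
        by_contra! h
        refine hcard (Nat.card_eq_two_iff.2 ⟨1, s, hs.symm, ?_⟩)
        refine Set.eq_univ_of_forall fun t => ?_
        simpa using or_iff_not_imp_left.2 (h t)
      exact ⟨{s, t}, by simp, Finset.card_le_two, by simp [hs.symm, ht.1.symm], by simp [hinvol],
        .inr (Finset.card_pair ht.2.symm)⟩
  · obtain ⟨s, hs⟩ := not_forall.1 hinvol
    have hs_one : s ≠ 1 := by rintro rfl; exact hs inv_one
    exact ⟨{s, s⁻¹}, by simp, Finset.card_le_two, by simp [hs_one.symm, eq_comm, hs_one],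
      by simp, .inr (Finset.card_pair (Ne.symm hs))⟩

theorem card_mul_le_hittingSqSum {T : Finset A} (hone : (1 : A) ∉ T) {c : ℝ≥0∞}
    (hc : ∀ a ∈ T, c ≤ hitting μ z a) : T.card * c ^ 2 ≤ hittingSqSum μ z := by
  calc (T.card : ℝ≥0∞) * c ^ 2 = ∑ a ∈ T, c ^ 2 := by simp
    _ ≤ ∑ a ∈ T, Set.indicator {a | a ≠ 1} (hitting μ z · ^ 2) a := by
        refine Finset.sum_le_sum fun a ha => ?_
        rw [Set.indicator_of_mem (by rintro rfl; exact hone ha)]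
        gcongr
        exact hc a ha
    _ ≤ ∑' a, Set.indicator {a | a ≠ 1} (hitting μ z · ^ 2) a := ENNReal.sum_le_tsum T
    _ = hittingSqSum μ z := (tsum_subtype {a : A | a ≠ 1} (hitting μ z · ^ 2)).symm

theorem exists_measure_card_mul_le_hittingSqSum [Group.FG A] {T : Finset A} (hT : T.Nonempty)
    (hone : (1 : A) ∉ T) (hinv : ∀ t ∈ T, t⁻¹ ∈ T) (hcard : T.card ≤ 2) {c : ℝ} (hc : c < 1) :
    ∃ μ : PMF A, ∃ z < 1, IsFinitelySupported μ ∧ IsSymmetric μ ∧ IsAdmissible μ ∧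
      T.card * ENNReal.ofReal c ^ 2 ≤ hittingSqSum μ z := by
  set u : ℝ := 1 - (1 - c) ^ 2 / 4 with hu
  have hu_lt : u < 1 := by rw [hu]; nlinarith [sq_pos_of_pos (sub_pos.2 hc)]
  have hu_enn : ENNReal.ofReal u < 1 := by simpa using hu_lt
  obtain ⟨μ, hfin, hsymm, hadm, hμT⟩ := exists_symmetric_admissible_le hT hinv hu_enn
  refine ⟨μ, ENNReal.ofReal u, hu_enn, hfin, hsymm, hadm,
    card_mul_le_hittingSqSum hone fun a ha => ?_⟩
  have hq : ∀ t ∈ T, ENNReal.ofReal u * ENNReal.ofReal u ≤ T.card * (ENNReal.ofReal u * μ t) :=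
    fun t ht => by
      rw [mul_left_comm]
      gcongr
      exact hμT t ht
  have hsq := sq_one_sub_hitting_le hu_enn hone hinv hcard hq ha
  have hle : (1 - (hitting μ (ENNReal.ofReal u) a).toReal) ^ 2 ≤ (1 - c) ^ 2 := by
    rw [ENNReal.toReal_mul, ENNReal.toReal_ofReal'] at hsq
    nlinarith [le_max_left u 0, max_lt hu_lt one_pos, le_max_right u 0]
  exact ENNReal.ofReal_le_of_le_toReal
    (by linarith [abs_le_of_sq_le_sq' hle (sub_pos.2 hc).le])

end Concentration

open Monoid CoprodI

section Words

variable {ι : Type*} {M : ι → Type*}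

/-- The product of the weights `γ` of the letters of a list. -/
def letterProd (γ : ∀ i, M i → ℝ≥0∞) (l : List (Σ i, M i)) : ℝ≥0∞ :=
  (l.map fun a => γ a.1 a.2).prod

/-- The product of the weights `γ` of all letters of a list but the last one, which has the weight
`δ` instead. -/
def letterProdLast (γ δ : ∀ i, M i → ℝ≥0∞) : List (Σ i, M i) → ℝ≥0∞
  | [] => 1
  | [a] => δ a.1 a.2
  | a :: b :: l => γ a.1 a.2 * letterProdLast γ δ (b :: l)

theorem letterProd_sq (γ : ∀ i, M i → ℝ≥0∞) (l : List (Σ i, M i)) :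
    letterProd (fun i a => γ i a ^ 2) l = letterProd γ l ^ 2 := by
  induction l with
  | nil => simp [letterProd]
  | cons a l ih => simp only [letterProd, List.map_cons, List.prod_cons, mul_pow] at ih ⊢; rw [ih]

theorem letterProdLast_self (γ : ∀ i, M i → ℝ≥0∞) :
    ∀ l : List (Σ i, M i), letterProdLast γ γ l = letterProd γ l
  | [] => by simp [letterProdLast, letterProd]
  | [a] => by simp [letterProdLast, letterProd]
  | a :: b :: l => by simp [letterProdLast, letterProdLast_self γ (b :: l), letterProd]

variable [∀ i, Group (M i)]

/-- The reduced words of length `k + 1` which start in the factor `j` are obtained from those of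
length `k` which do not by prepending a letter. -/
def consEquiv (M : ι → Type*) [∀ i, Group (M i)] (j : ι) (k : ℕ) :
    {a : M j // a ≠ 1} × {t : Word M // t.toList.length = k ∧ t.fstIdx ≠ some j} ≃
      {w : Word M // w.toList.length = k + 1 ∧ w.fstIdx = some j} :=
  Equiv.ofBijective
    (fun p => ⟨Word.cons p.1.1 p.2.1 p.2.2.2 p.1.2, by simp [p.2.2.1], by simp⟩) <| by
    constructor
    · rintro ⟨⟨a, ha⟩, ⟨t, ht⟩⟩ ⟨⟨b, hb⟩, ⟨s, hs⟩⟩ h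
      have hlist := congrArg (fun w => w.1.toList) h
      simp only [Word.cons_toList, List.cons.injEq, Sigma.mk.injEq, heq_eq_eq, true_and] at hlist
      obtain ⟨rfl, hts⟩ := hlist
      obtain rfl := Word.ext hts
      rfl
    · rintro ⟨w, hlen, hfst⟩
      induction w using Word.consRecOn with
      | empty => simp at hlen
      | cons i a t ht ha _ =>
        obtain rfl : i = j := by simpa using hfst
        exact ⟨⟨⟨a, ha⟩, ⟨t, by simpa using hlen, ht⟩⟩, rfl⟩

theorem tsum_letterProd_fstIdx_eq (γ : ∀ i, M i → ℝ≥0∞) (j : ι) (k : ℕ) :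
    ∑' w : {w : Word M // w.toList.length = k + 1 ∧ w.fstIdx = some j}, letterProd γ w.1.toList =
      (∑' a : {a : M j // a ≠ 1}, γ j a) *
        ∑' t : {t : Word M // t.toList.length = k ∧ t.fstIdx ≠ some j},
          letterProd γ t.1.toList := by
  rw [← (consEquiv M j k).tsum_eq, ENNReal.tsum_prod', ← ENNReal.tsum_mul_right]
  refine tsum_congr fun a => ?_
  rw [← ENNReal.tsum_mul_left]
  exact tsum_congr fun t => List.prod_cons

variable [DecidableEq ι] [∀ i, DecidableEq (M i)]

theorem letterProdLast_of_smul {γ δ : ∀ i, M i → ℝ≥0∞} {i : ι} (hγ : γ i 1 = 1) (a : M i)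
    {t : Word M} (ht : t.fstIdx ≠ some i) (h : t ≠ Word.empty ∨ δ i = γ i) :
    letterProdLast γ δ ((of a : CoprodI M) • t).toList = γ i a * letterProdLast γ δ t.toList := by
  by_cases ha : a = 1
  · simp [ha, hγ]
  rw [← Word.cons_eq_smul (h1 := ht) (h2 := ha), Word.cons_toList]
  rcases hl : t.toList with _ | ⟨b, l⟩
  · have hδ := h.resolve_left fun hne => hne (Word.ext hl)
    simp [letterProdLast, hδ]
  · rfl

theorem length_of_smul_le {i : ι} (a : M i) (w : Word M) :
    ((of a : CoprodI M) • w).toList.length ≤ w.toList.length + 1 := by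
  have length_le : ∀ (b : M i) (t : Word M), t.fstIdx ≠ some i →
      t.toList.length ≤ ((of b : CoprodI M) • t).toList.length ∧
        ((of b : CoprodI M) • t).toList.length ≤ t.toList.length + 1 := fun b t ht => by
    by_cases hb : b = 1
    · simp [hb]
    · rw [← Word.cons_eq_smul (h1 := ht) (h2 := hb)]
      simp
  set p := Word.equivPair i w
  have hw : (of p.head : CoprodI M) • p.tail = w := by
    rw [← Word.rcons_eq_smul]
    exact (Word.equivPair i).symm_apply_apply w
  calc ((of a : CoprodI M) • w).toList.length
      = ((of (a * p.head) : CoprodI M) • p.tail).toList.length := by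
        rw [map_mul, mul_smul, hw]
    _ ≤ p.tail.toList.length + 1 := (length_le _ _ p.fstIdx_ne).2
    _ ≤ ((of p.head : CoprodI M) • p.tail).toList.length + 1 := by
        gcongr
        exact (length_le _ _ p.fstIdx_ne).1
    _ = w.toList.length + 1 := by rw [hw]

end Words

section SphereSums

variable {M : Bool → Type*} [∀ i, Group (M i)] {γ : ∀ i, M i → ℝ≥0∞}

/-- The total weight of the reduced words of length `k` that do not start in the factor `i`. -/
def levelSum (γ : ∀ i, M i → ℝ≥0∞) (i : Bool) (k : ℕ) : ℝ≥0∞ :=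
  ∑' t : {t : Word M // t.toList.length = k ∧ t.fstIdx ≠ some i}, letterProd γ t.1.toList

/-- The total weight of the reduced words of length `k`. -/
def sphereSum (γ : ∀ i, M i → ℝ≥0∞) (k : ℕ) : ℝ≥0∞ :=
  ∑' w : {w : Word M // w.toList.length = k}, letterProd γ w.1.toList

theorem levelSum_zero (γ : ∀ i, M i → ℝ≥0∞) (i : Bool) : levelSum γ i 0 = 1 := by
  rw [levelSum, tsum_eq_single ⟨Word.empty, by simp [Word.fstIdx]⟩]
  · simp [letterProd]
  · rintro ⟨t, ht, _⟩ hne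
    exact absurd (Subtype.ext (Word.ext (List.eq_nil_of_length_eq_zero ht))) hne

theorem sphereSum_zero (γ : ∀ i, M i → ℝ≥0∞) : sphereSum γ 0 = 1 := by
  rw [sphereSum, tsum_eq_single ⟨Word.empty, by simp⟩]
  · simp [letterProd]
  · rintro ⟨t, ht⟩ hne
    exact absurd (Subtype.ext (Word.ext (List.eq_nil_of_length_eq_zero ht))) hne

theorem fstIdx_eq_or_eq_of_length {k : ℕ} {w : Word M} (hw : w.toList.length = k + 1) (i : Bool) :
    w.fstIdx = some i ∨ w.fstIdx = some (!i) := by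
  induction w using Word.consRecOn with
  | empty => simp at hw
  | cons j => simpa using Bool.eq_or_eq_not j i

theorem levelSum_succ (γ : ∀ i, M i → ℝ≥0∞) (i : Bool) (k : ℕ) :
    levelSum γ i (k + 1) = (∑' a : {a : M (!i) // a ≠ 1}, γ (!i) a) * levelSum γ (!i) k := by
  rw [levelSum, levelSum, ← tsum_letterProd_fstIdx_eq]
  refine tsum_congr_set_coe (fun w : Word M => letterProd γ w.toList)
    (Set.ext fun w => and_congr_right fun hw => ?_)
  rcases fstIdx_eq_or_eq_of_length hw i with h | h <;> simp [h]

theorem sphereSum_succ (γ : ∀ i, M i → ℝ≥0∞) (k : ℕ) :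
    sphereSum γ (k + 1) = levelSum γ true (k + 1) + levelSum γ false (k + 1) := by
  set start : Bool → Set (Word M) := fun i => {w | w.toList.length = k + 1 ∧ w.fstIdx ≠ some i}
  have hunion : {w : Word M | w.toList.length = k + 1} = start true ∪ start false := by
    ext w
    refine ⟨fun hw => ?_, fun hw => hw.elim And.left And.left⟩
    rcases fstIdx_eq_or_eq_of_length hw true with h | h
    · exact .inr ⟨hw, by simp [h]⟩
    · exact .inl ⟨hw, by simp [h]⟩
  have hdisj : Disjoint (start true) (start false) := Set.disjoint_left.2 fun w ht hf =>
    (fstIdx_eq_or_eq_of_length ht.1 true).elim ht.2 hf.2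
  calc sphereSum γ (k + 1) = ∑' w : ↑(start true ∪ start false), letterProd γ w.1.toList :=
        tsum_congr_set_coe (fun w : Word M => letterProd γ w.toList) hunion
    _ = levelSum γ true (k + 1) + levelSum γ false (k + 1) :=
        ENNReal.summable.tsum_union_disjoint (f := fun w : Word M => letterProd γ w.toList) hdisj
          ENNReal.summable

theorem levelSum_ne_top (hγ : ∀ i, ∑' a : {a : M i // a ≠ 1}, γ i a ≠ ∞) (i : Bool) (k : ℕ) :
    levelSum γ i k ≠ ∞ := by
  induction k generalizing i with
  | zero => simp [levelSum_zero]
  | succ k ih => rw [levelSum_succ]; exact ENNReal.mul_ne_top (hγ _) (ih _)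

theorem sphereSum_ne_top (hγ : ∀ i, ∑' a : {a : M i // a ≠ 1}, γ i a ≠ ∞) (k : ℕ) :
    sphereSum γ k ≠ ∞ := by
  cases k with
  | zero => simp [sphereSum_zero]
  | succ k =>
    rw [sphereSum_succ]
    exact ENNReal.add_ne_top.2 ⟨levelSum_ne_top hγ _ _, levelSum_ne_top hγ _ _⟩

theorem tsum_ite_length_eq (γ : ∀ i, M i → ℝ≥0∞) (k : ℕ) :
    ∑' w : Word M, (if w.toList.length = k then letterProd γ w.toList else 0) = sphereSum γ k := by
  rw [sphereSum]
  refine .trans (tsum_congr fun w => ?_)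
    (tsum_subtype {w : Word M | w.toList.length = k} fun w => letterProd γ w.toList).symm
  simp [Set.indicator_apply]

theorem tsum_ite_length_le (γ : ∀ i, M i → ℝ≥0∞) (N : ℕ) :
    ∑' w : Word M, (if w.toList.length ≤ N then letterProd γ w.toList else 0) =
      ∑ k ∈ Finset.range (N + 1), sphereSum γ k := by
  simp_rw [← tsum_ite_length_eq]
  rw [← Summable.tsum_finsetSum fun _ _ => ENNReal.summable]
  refine tsum_congr fun w => ?_
  rw [Finset.sum_ite_eq]
  simp

section CriticalWeight

variable (hγ : ∀ i, (∑' a : {a : M i // a ≠ 1}, γ i a) *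
  ∑' a : {a : M (!i) // a ≠ 1}, γ (!i) a = 1)
include hγ

theorem levelSum_two_mul (i : Bool) (k : ℕ) : levelSum γ i (2 * k) = 1 := by
  induction k with
  | zero => exact levelSum_zero γ i
  | succ k ih =>
    rw [Nat.mul_succ, levelSum_succ, levelSum_succ, ← mul_assoc, Bool.not_not, ih, mul_one,
      mul_comm, hγ]

theorem sphereSum_two_mul_succ (k : ℕ) : sphereSum γ (2 * (k + 1)) = 2 := by
  have hlevel := fun i => levelSum_two_mul hγ i (k + 1)
  rw [Nat.mul_succ] at hlevel ⊢
  rw [sphereSum_succ, hlevel, hlevel, one_add_one_eq_two]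

theorem sphereSum_two_mul_le (k : ℕ) : sphereSum γ (2 * k) ≤ 2 := by
  cases k with
  | zero => rw [mul_zero, sphereSum_zero]; exact one_le_two
  | succ k => exact (sphereSum_two_mul_succ hγ k).le

theorem natCast_le_sum_sphereSum (N : ℕ) :
    (N : ℝ≥0∞) ≤ ∑ k ∈ Finset.range (2 * N + 1), sphereSum γ k := by
  induction N with
  | zero => simp
  | succ N ih =>
    calc ((N + 1 : ℕ) : ℝ≥0∞) = N + 1 := Nat.cast_succ N
      _ ≤ ∑ k ∈ Finset.range (2 * N + 1), sphereSum γ k + sphereSum γ (2 * (N + 1)) := by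
          rw [sphereSum_two_mul_succ hγ]
          exact add_le_add ih one_le_two
      _ ≤ ∑ k ∈ Finset.range (2 * (N + 1)), sphereSum γ k + sphereSum γ (2 * (N + 1)) := by
          gcongr
          omega
      _ = ∑ k ∈ Finset.range (2 * (N + 1) + 1), sphereSum γ k := (Finset.sum_range_succ ..).symm

end CriticalWeight

end SphereSums

section WordWalk

variable {M : Bool → Type*} [∀ i, Group (M i)] {m : ∀ i, PMF (M i)}
  {α c z : Bool → ℝ≥0∞} {r : ℝ≥0∞}

/-- The product of the normalised Green functions of the letters of a reduced word of length at
most `N`, and zero for longer words. -/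
def ballWeight (m : ∀ i, PMF (M i)) (z : Bool → ℝ≥0∞) (N : ℕ) (w : Word M) : ℝ≥0∞ :=
  if w.toList.length ≤ N then letterProd (fun i => hitting (m i) (z i)) w.toList else 0

/-- The product of the normalised Green functions of the letters of a reduced word, where a last
letter in the factor `i` is not counted. At the reduced word of `x⁻¹` it depends only on the coset
of `x` under left multiplication by that factor. -/
def cosetWeight (m : ∀ i, PMF (M i)) (z : Bool → ℝ≥0∞) (i : Bool) (w : Word M) : ℝ≥0∞ :=
  letterProdLast (fun j => hitting (m j) (z j))
    (Function.update (fun j => hitting (m j) (z j)) i 1) w.toList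

theorem tsum_ballWeight_sq (m : ∀ i, PMF (M i)) (z : Bool → ℝ≥0∞) (N : ℕ) :
    ∑' w, ballWeight m z N w ^ 2 =
      ∑ k ∈ Finset.range (N + 1), sphereSum (fun i a => hitting (m i) (z i) a ^ 2) k := by
  rw [← tsum_ite_length_le]
  refine tsum_congr fun w => ?_
  rw [letterProd_sq, ballWeight]
  split_ifs <;> simp

theorem tsum_ballWeight_ne_top (hm : ∀ i, IsSymmetric (m i)) (hz : ∀ i, z i < 1) (N : ℕ) :
    ∑' w, ballWeight m z N w ≠ ∞ := by
  simp only [ballWeight]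
  rw [tsum_ite_length_le]
  refine ENNReal.sum_ne_top.2 fun k _ => sphereSum_ne_top (fun i => ?_) k
  refine ne_top_of_le_ne_top (tsum_green_ne_top (hm i) (hz i)) ?_
  exact (ENNReal.tsum_comp_le_tsum_of_injective Subtype.val_injective _).trans
    (ENNReal.tsum_le_tsum fun a => hitting_le_green (m i) (z i) a)

variable [∀ i, DecidableEq (M i)]

/-- The transition operator of the walk on reduced words which, with weight `α i`, multiplies the
word on the left by an element of `M i` chosen according to `m i`. -/
def wordStep (α : Bool → ℝ≥0∞) (m : ∀ i, PMF (M i)) (f : Word M → ℝ≥0∞) (w : Word M) : ℝ≥0∞ :=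
  ∑ i, α i * ∑' a : M i, m i a * f ((of a : CoprodI M) • w)

theorem tsum_of_smul_of_smul {i : Bool} (hm : IsSymmetric (m i)) {z : ℝ≥0∞}
    {f : Word M → ℝ≥0∞} {t : Word M}
    (hf : ∀ a : M i, f ((of a : CoprodI M) • t) = hitting (m i) z a * f t) {b : M i} (hb : b ≠ 1) :
    z * ∑' a : M i, m i a * f ((of a : CoprodI M) • (of b : CoprodI M) • t) =
      f ((of b : CoprodI M) • t) := by
  simp_rw [smul_smul, ← map_mul, hf, ← mul_assoc]
  rw [ENNReal.tsum_mul_right, ← mul_assoc, hitting_harmonic_left hm hb]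

theorem tsum_of_smul_eq_returnGen {i : Bool} {z : ℝ≥0∞} {f : Word M → ℝ≥0∞} {t : Word M}
    (hf : ∀ a : M i, f ((of a : CoprodI M) • t) = hitting (m i) z a * f t) :
    z * ∑' a : M i, m i a * f ((of a : CoprodI M) • t) = returnGen (m i) z * f t := by
  simp_rw [hf, ← mul_assoc]
  rw [ENNReal.tsum_mul_right, ← mul_assoc, returnGen]

theorem fstIdx_of_smul {i : Bool} {b : M i} (hb : b ≠ 1) {t : Word M} (ht : t.fstIdx ≠ some i) :
    ((of b : CoprodI M) • t).fstIdx = some i := by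
  rw [← Word.cons_eq_smul (h1 := ht) (h2 := hb), Word.fstIdx_cons]

theorem mul_wordStep (hα : ∀ i, r * α i = c i * z i) (f : Word M → ℝ≥0∞) (w : Word M) (i : Bool) :
    r * wordStep α m f w =
      c i * (z i * ∑' a : M i, m i a * f ((of a : CoprodI M) • w)) +
        c (!i) * (z (!i) * ∑' a : M (!i), m (!i) a * f ((of a : CoprodI M) • w)) := by
  rw [wordStep, Finset.mul_sum, Fintype.sum_bool]
  simp_rw [← mul_assoc, hα]
  cases i
  · exact add_comm _ _
  · rfl

theorem cosetWeight_of_smul_empty (i : Bool) (b : M i) :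
    cosetWeight m z i ((of b : CoprodI M) • Word.empty) = 1 := by
  by_cases hb : b = 1
  · simp [hb, cosetWeight, letterProdLast]
  · rw [← Word.cons_eq_smul (h1 := by simp [Word.fstIdx]) (h2 := hb)]
    simp [cosetWeight, letterProdLast]

section Harmonic

/- At a word which starts in the factor `i`, harmonicity of `hitting (m i) (z i)` makes the steps in
that factor contribute `c i` times the value, and those in the other factor start from its identity
and contribute `c (!i) * returnGen (m (!i)) (z (!i))` times the value. -/
variable (hz : ∀ i, z i < 1) (hα : ∀ i, r * α i = c i * z i)
  (hc : ∀ i, c i + c (!i) * returnGen (m (!i)) (z (!i)) = 1)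
include hz hα

theorem mul_wordStep_cosetWeight_of_smul_empty (i : Bool) (b : M i) :
    r * wordStep α m (cosetWeight m z i) ((of b : CoprodI M) • Word.empty) =
      c i * z i + c (!i) * returnGen (m (!i)) (z (!i)) := by
  have hfst : ((of b : CoprodI M) • (Word.empty : Word M)).fstIdx ≠ some (!i) := by
    by_cases hb : b = 1
    · simp [hb, Word.fstIdx]
    · simp [fstIdx_of_smul hb (t := (Word.empty : Word M)) (by simp [Word.fstIdx])]
  rw [mul_wordStep hα _ _ i, tsum_of_smul_eq_returnGen (z := z (!i)) fun a =>
    letterProdLast_of_smul (hitting_one (m (!i)) (hz (!i))) a hfst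
      (.inr (Function.update_of_ne (by simp) _ _))]
  simp_rw [smul_smul, ← map_mul, cosetWeight_of_smul_empty]
  simp [PMF.tsum_coe]

include hc

theorem mul_wordStep_letterProdLast (hm : ∀ i, IsSymmetric (m i)) {δ : ∀ i, M i → ℝ≥0∞}
    {w : Word M} (hw : w ≠ Word.empty)
    (hδ : ∀ (i : Bool) (b : M i), w = (of b : CoprodI M) • Word.empty →
      δ i = hitting (m i) (z i)) :
    r * wordStep α m (fun v => letterProdLast (fun i => hitting (m i) (z i)) δ v.toList) w =
      letterProdLast (fun i => hitting (m i) (z i)) δ w.toList := by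
  induction w using Word.consRecOn with
  | empty => exact absurd rfl hw
  | cons i b t ht hb =>
    have hone := fun j => hitting_one (m j) (hz j)
    set f := fun v : Word M => letterProdLast (fun i => hitting (m i) (z i)) δ v.toList
    rw [Word.cons_eq_smul] at hw hδ ⊢
    have hmul : ∀ a : M i, f ((of a : CoprodI M) • t) = hitting (m i) (z i) a * f t := fun a => by
      refine letterProdLast_of_smul (hone i) a ht (or_iff_not_imp_left.2 fun hempty => hδ i b ?_)
      rw [not_not.1 hempty]
    have hmul' : ∀ a : M (!i), f ((of a : CoprodI M) • (of b : CoprodI M) • t) =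
        hitting (m (!i)) (z (!i)) a * f ((of b : CoprodI M) • t) := fun a =>
      letterProdLast_of_smul (hone (!i)) a (by simp [fstIdx_of_smul hb ht]) (.inl hw)
    calc r * wordStep α m f ((of b : CoprodI M) • t)
        = c i * f ((of b : CoprodI M) • t) +
            c (!i) * (returnGen (m (!i)) (z (!i)) * f ((of b : CoprodI M) • t)) := by
          rw [mul_wordStep hα f _ i, tsum_of_smul_of_smul (hm i) hmul hb,
            tsum_of_smul_eq_returnGen hmul']
      _ = f ((of b : CoprodI M) • t) := by rw [← mul_assoc, ← add_mul, hc, one_mul]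

theorem mul_wordStep_cosetWeight (hm : ∀ i, IsSymmetric (m i)) {i : Bool} {w : Word M}
    (hw : ∀ b : M i, w ≠ (of b : CoprodI M) • Word.empty) :
    r * wordStep α m (cosetWeight m z i) w = cosetWeight m z i w := by
  refine mul_wordStep_letterProdLast hz hα hc hm (by simpa using hw 1) fun j b hwb => ?_
  refine Function.update_of_ne ?_ _ _
  rintro rfl
  exact hw b hwb

theorem mul_wordStep_ballWeight (hm : ∀ i, IsSymmetric (m i)) {N : ℕ} {w : Word M}
    (hw : w ≠ Word.empty) (hN : w.toList.length < N) :
    r * wordStep α m (ballWeight m z N) w = ballWeight m z N w := by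
  have hball : ∀ v : Word M, v.toList.length ≤ N → ballWeight m z N v =
      letterProdLast (fun i => hitting (m i) (z i)) (fun i => hitting (m i) (z i)) v.toList :=
    fun v hv => by rw [ballWeight, if_pos hv, letterProdLast_self]
  rw [hball w hN.le, ← mul_wordStep_letterProdLast hz hα hc hm hw fun _ _ _ => rfl]
  unfold wordStep
  congr! 6 with i _ a
  exact hball _ ((length_of_smul_le a w).trans hN)

theorem ballWeight_sq_le (hm : ∀ i, IsSymmetric (m i)) (N : ℕ) (w : Word M) :
    ballWeight m z N w ^ 2 ≤ r * (ballWeight m z N w * wordStep α m (ballWeight m z N) w) +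
      ((if w.toList.length = 0 then letterProd (fun i a => hitting (m i) (z i) a ^ 2) w.toList
          else 0) +
        if w.toList.length = N then letterProd (fun i a => hitting (m i) (z i) a ^ 2) w.toList
          else 0) := by
  rcases lt_trichotomy w.toList.length N with hN | hN | hN
  · by_cases hw : w.toList.length = 0
    · refine le_trans ?_ (le_add_self.trans (add_le_add_right le_self_add _))
      simp [ballWeight, hw, letterProd_sq]
    · rw [mul_left_comm, mul_wordStep_ballWeight hz hα hc hm (by rintro rfl; simp at hw) hN, ← sq]
      exact le_self_add
  · simp [ballWeight, hN, letterProd_sq, ← add_assoc]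
  · simp [ballWeight, hN.not_ge]

theorem tsum_ballWeight_sq_le (hm : ∀ i, IsSymmetric (m i))
    (hcrit : ∀ i, hittingSqSum (m i) (z i) * hittingSqSum (m (!i)) (z (!i)) = 1) (N : ℕ) :
    ∑' w, ballWeight m z (2 * N) w ^ 2 ≤
      r * ∑' w, ballWeight m z (2 * N) w * wordStep α m (ballWeight m z (2 * N)) w + 3 := by
  refine (ENNReal.tsum_le_tsum (ballWeight_sq_le hz hα hc hm (2 * N))).trans ?_
  rw [ENNReal.tsum_add, ENNReal.tsum_mul_left, ENNReal.tsum_add, tsum_ite_length_eq,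
    tsum_ite_length_eq, sphereSum_zero]
  gcongr
  calc 1 + sphereSum (fun i a => hitting (m i) (z i) a ^ 2) (2 * N) ≤ 1 + 2 := by
        gcongr
        exact sphereSum_two_mul_le (γ := fun i a => hitting (m i) (z i) a ^ 2) hcrit N
    _ = 3 := by norm_num

end Harmonic

end WordWalk

section FreeProductWalk

variable {M : Bool → Type*} [∀ i, Group (M i)] {G : Type*} [Group G] (e : G ≃* CoprodI M)

/-- The inclusion of a factor into a group identified with a free product. -/
def factorHom (i : Bool) : M i →* G := e.symm.toMonoidHom.comp of

/-- The mixture, with weights `α`, of the measures `m i` on the factors of a free product. -/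
def mixture (α : PMF Bool) (m : ∀ i, PMF (M i)) : PMF G := α.bind fun i => (m i).map (factorHom e i)

theorem IsSymmetric.mixture {m : ∀ i, PMF (M i)} (hm : ∀ i, IsSymmetric (m i)) (α : PMF Bool) :
    IsSymmetric (mixture e α m) :=
  IsSymmetric.bind fun i => (hm i).map (factorHom e i)

theorem IsFinitelySupported.mixture {m : ∀ i, PMF (M i)} (hm : ∀ i, IsFinitelySupported (m i))
    (α : PMF Bool) : IsFinitelySupported (mixture e α m) :=
  IsFinitelySupported.bind (Set.toFinite _) fun i => (hm i).map (factorHom e i)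

theorem IsAdmissible.mixture {α : PMF Bool} (hα : ∀ i, α i ≠ 0) {m : ∀ i, PMF (M i)}
    (hm : ∀ i, IsAdmissible (m i)) : IsAdmissible (mixture e α m) := by
  set S := Subsemigroup.closure (RatioLimit.mixture e α m).support
  have hfactor : ∀ i (a : M i), factorHom e i a ∈ S := fun i => by
    suffices h : Subsemigroup.closure (m i).support ≤ S.comap (factorHom e i : M i →ₙ* G) from
      fun a => h ((hm i).ge trivial)
    refine Subsemigroup.closure_le.2 fun a ha => Subsemigroup.subset_closure ?_
    refine (PMF.mem_support_bind_iff ..).2 ⟨i, (α.mem_support_iff i).2 (hα i), ?_⟩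
    exact (PMF.mem_support_map_iff ..).2 ⟨a, ha, rfl⟩
  refine eq_top_iff.2 fun x _ => ?_
  rw [← e.symm_apply_apply x]
  induction e x using CoprodI.induction_on with
  | one => simpa using hfactor true 1
  | of i a => exact hfactor i a
  | mul u v hu hv => rw [map_mul]; exact mul_mem hu hv

variable [∀ i, DecidableEq (M i)]

/-- The reduced word of `x⁻¹`. The inversion turns the right multiplications of the random walk
into left multiplications, which act on the first letter of the word. -/
def invWord : G ≃ Word M := (Equiv.inv G).trans (e.toEquiv.trans Word.equiv)

theorem invWord_mul (x y : G) : invWord e (x * y) = e y⁻¹ • invWord e x := by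
  change e (x * y)⁻¹ • (Word.empty : Word M) = e y⁻¹ • e x⁻¹ • Word.empty
  rw [mul_inv_rev, map_mul, mul_smul]

theorem mem_range_factorHom_iff {i : Bool} {x : G} :
    x ∈ (factorHom e i).range ↔ ∃ a : M i, invWord e x = (of a : CoprodI M) • Word.empty := by
  rw [← inv_mem_iff, MonoidHom.mem_range]
  refine exists_congr fun a => ?_
  change e.symm (of a) = x⁻¹ ↔ Word.equiv (e x⁻¹) = Word.equiv (of a)
  rw [Word.equiv.apply_eq_iff_eq, MulEquiv.symm_apply_eq, eq_comm]

variable {m : ∀ i, PMF (M i)} (hm : ∀ i, IsSymmetric (m i)) {α : PMF Bool}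
include hm

theorem tsum_mixture_mul_invWord (f : Word M → ℝ≥0∞) (x : G) :
    ∑' g, mixture e α m g * f (invWord e (x * g)) = wordStep α m f (invWord e x) := by
  rw [mixture, tsum_bind_mul, tsum_fintype]
  refine Finset.sum_congr rfl fun i _ => ?_
  rw [tsum_map_mul, ← (Equiv.inv (M i)).tsum_eq]
  congr 1
  refine tsum_congr fun a => ?_
  rw [Equiv.inv_apply, hm, invWord_mul]
  simp [factorHom]

variable {c z : Bool → ℝ≥0∞} {r : ℝ≥0∞} (hz : ∀ i, z i < 1) (hα : ∀ i, r * α i = c i * z i)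
  (hc : ∀ i, c i + c (!i) * returnGen (m (!i)) (z (!i)) = 1)
include hz hα hc

omit [∀ i, DecidableEq (M i)] in
theorem walkR_mixture_le
    (hcrit : ∀ i, hittingSqSum (m i) (z i) * hittingSqSum (m (!i)) (z (!i)) = 1) :
    walkR (mixture e α m) ≤ r := by
  classical
  refine walkR_le_of_test_functions (IsSymmetric.mixture e hm α) (C := 3) (by simp)
    (fun N x => ballWeight m z (2 * N) (invWord e x)) (fun N => ?_) (fun N => ?_) ?_
  · rw [(invWord e).tsum_eq (ballWeight m z (2 * N))]
    exact tsum_ballWeight_ne_top hm hz _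
  · simp_rw [tsum_mixture_mul_invWord e hm]
    rw [(invWord e).tsum_eq fun w => ballWeight m z (2 * N) w ^ 2, (invWord e).tsum_eq fun w =>
      ballWeight m z (2 * N) w * wordStep α m (ballWeight m z (2 * N)) w]
    exact tsum_ballWeight_sq_le hz hα hc hm hcrit N
  · refine tendsto_nhds_top_mono' ENNReal.tendsto_nat_nhds_top fun N => ?_
    rw [(invWord e).tsum_eq fun w => ballWeight m z (2 * N) w ^ 2, tsum_ballWeight_sq]
    exact natCast_le_sum_sphereSum (γ := fun i a => hitting (m i) (z i) a ^ 2) hcrit N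

omit [∀ i, DecidableEq (M i)] in
theorem not_isSpectrallyDegenerateAlong_range (hR : walkR (mixture e α m) ≤ r) {i : Bool}
    (hi : c i * z i < c i) :
    ¬ IsSpectrallyDegenerateAlong (mixture e α m) (factorHom e i).range := by
  classical
  have hfin : c (!i) * returnGen (m (!i)) (z (!i)) ≠ ∞ :=
    ne_top_of_le_ne_top ENNReal.one_ne_top (hc i ▸ le_add_self)
  have hlt : c i * z i + c (!i) * returnGen (m (!i)) (z (!i)) < 1 :=
    hc i ▸ (ENNReal.add_lt_add_iff_right hfin).2 hi
  refine not_isSpectrallyDegenerateAlong hR hlt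
    (φ := fun x => cosetWeight m z i (invWord e x)) (fun x hx => ?_) (fun x hx => ?_) fun x hx => ?_
  · obtain ⟨a, ha⟩ := (mem_range_factorHom_iff e).1 hx
    rw [ha, cosetWeight_of_smul_empty]
  · rw [tsum_mixture_mul_invWord e hm]
    refine (mul_wordStep_cosetWeight hz hα hc hm fun b hb => hx ?_).le
    exact (mem_range_factorHom_iff e).2 ⟨b, hb⟩
  · obtain ⟨a, ha⟩ := (mem_range_factorHom_iff e).1 hx
    rw [tsum_mixture_mul_invWord e hm, ha]
    exact (mul_wordStep_cosetWeight_of_smul_empty hz hα i a).le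

end FreeProductWalk

section Parameters

theorem exists_add_mul_eq_one {U V : Bool → ℝ≥0∞} (hUV : ∀ i, U i + V i = 1)
    (hV : ∀ i, V i ≠ 0) :
    ∃ c : Bool → ℝ≥0∞, (∀ i, c i ≠ 0) ∧ (∀ i, c i ≠ ∞) ∧ ∀ i, c i + c (!i) * U (!i) = 1 := by
  set D := V true + V false * U true with hD
  have hD_eq : ∀ i, V (!i) + V i * U (!i) = D
    | false => rfl
    | true => by
      calc V false + V true * U false
          = V false * (U true + V true) + V true * U false := by rw [hUV, mul_one]
        _ = V true * (U false + V false) + V false * U true := by ring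
        _ = D := by rw [hUV, mul_one]
  have hU_ne_top : ∀ i, U i ≠ ∞ := fun i =>
    ne_top_of_le_ne_top ENNReal.one_ne_top (hUV i ▸ le_self_add)
  have hV_ne_top : ∀ i, V i ≠ ∞ := fun i =>
    ne_top_of_le_ne_top ENNReal.one_ne_top (hUV i ▸ le_add_self)
  have hD_ne_zero : D ≠ 0 := by simp [hD, hV]
  have hD_ne_top : D ≠ ∞ := by simp [hD, ENNReal.mul_ne_top, hU_ne_top, hV_ne_top]
  refine ⟨fun i => V (!i) / D, fun i => ?_, fun i => ?_, fun i => ?_⟩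
  · exact (ENNReal.div_pos (hV _) hD_ne_top).ne'
  · exact ENNReal.div_ne_top (hV_ne_top _) hD_ne_zero
  · beta_reduce
    rw [Bool.not_not, ENNReal.mul_comm_div, mul_div_assoc', ← ENNReal.add_div, hD_eq,
      ENNReal.div_self hD_ne_zero hD_ne_top]

theorem exists_pmf_mul_eq {ι : Type*} [Finite ι] [Nonempty ι] {w : ι → ℝ≥0∞}
    (hw : ∀ i, w i ≠ 0) (hw' : ∀ i, w i ≠ ∞) :
    ∃ (α : PMF ι) (r : ℝ≥0∞), (∀ i, α i ≠ 0) ∧ ∀ i, r * α i = w i := by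
  have := Fintype.ofFinite ι
  have hsum : ∑' i, w i ≠ 0 := by simp [hw]
  have hsum' : ∑' i, w i ≠ ∞ := by simp [hw']
  refine ⟨PMF.normalize w hsum hsum', ∑' i, w i, fun i => ?_, fun i => ?_⟩
  · rw [PMF.normalize_apply]
    exact mul_ne_zero (hw i) (ENNReal.inv_ne_zero.2 hsum')
  · rw [PMF.normalize_apply, mul_left_comm, ENNReal.mul_inv_cancel hsum hsum', mul_one]

end Parameters

section Existence

variable (M : Bool → Type*) [∀ i, Group (M i)] [∀ i, Group.FG (M i)] [∀ i, Nontrivial (M i)]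

theorem exists_one_le_hittingSqSum_mul (hM : ∃ i, Nat.card (M i) ≠ 2) :
    ∃ (m : ∀ i, PMF (M i)) (z : Bool → ℝ≥0∞), (∀ i, z i < 1) ∧ (∀ i, IsFinitelySupported (m i)) ∧
      (∀ i, IsSymmetric (m i)) ∧ (∀ i, IsAdmissible (m i)) ∧
      1 ≤ hittingSqSum (m true) (z true) * hittingSqSum (m false) (z false) := by
  choose T hne hle hone hinv hcard using fun i => exists_symmetric_subset_card_le_two (M i)
  choose m z hz hfin hsymm hadm hsum using fun i => exists_measure_card_mul_le_hittingSqSum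
    (hne i) (hone i) (hinv i) (hle i) (c := 9 / 10) (by norm_num)
  have htwo : 2 ≤ (T true).card * (T false).card := by
    have hpos := fun i => (hne i).card_pos
    rw [Bool.exists_bool] at hM
    rcases hM with h | h
    · rw [(hcard false).resolve_left h]; linarith [hpos true]
    · rw [(hcard true).resolve_left h]; linarith [hpos false]
  refine ⟨m, z, hz, hfin, hsymm, hadm, ?_⟩
  calc (1 : ℝ≥0∞) ≤ 2 * ENNReal.ofReal (9 / 10) ^ 4 := by
        rw [← ENNReal.ofReal_pow (by norm_num), ← ENNReal.ofReal_ofNat 2,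
          ← ENNReal.ofReal_mul (by norm_num), ENNReal.one_le_ofReal]
        norm_num
    _ ≤ ((T true).card * (T false).card : ℕ) * ENNReal.ofReal (9 / 10) ^ 4 := by
        gcongr
        exact_mod_cast htwo
    _ = ((T true).card * ENNReal.ofReal (9 / 10) ^ 2) *
          ((T false).card * ENNReal.ofReal (9 / 10) ^ 2) := by push_cast; ring
    _ ≤ hittingSqSum (m true) (z true) * hittingSqSum (m false) (z false) := by
        gcongr <;> exact hsum _

theorem exists_hittingSqSum_mul_eq_one (hM : ∃ i, Nat.card (M i) ≠ 2) :
    ∃ (m : ∀ i, PMF (M i)) (z : Bool → ℝ≥0∞), (∀ i, z i < 1) ∧ (∀ i, IsFinitelySupported (m i)) ∧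
      (∀ i, IsSymmetric (m i)) ∧ (∀ i, IsAdmissible (m i)) ∧
      ∀ i, hittingSqSum (m i) (z i) * hittingSqSum (m (!i)) (z (!i)) = 1 := by
  obtain ⟨m, z, hz, hfin, hsymm, hadm, hone⟩ := exists_one_le_hittingSqSum_mul M hM
  set A := hittingSqSum (m false) (z false)
  have hA_ne_top : A ≠ ∞ := hittingSqSum_ne_top (hsymm false) (hz false)
  have hA_ne_zero : A ≠ 0 := right_ne_zero_of_mul (zero_lt_one.trans_le hone).ne'
  obtain ⟨w, hw, hsum⟩ := exists_hittingSqSum_eq (hsymm true) (hz true)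
    ((ENNReal.inv_le_iff_le_mul (fun _ => hA_ne_zero) fun h => absurd h hA_ne_top).2
      (hone.trans_eq (mul_comm _ _)))
  have hmul : hittingSqSum (m true) w * A = 1 := by
    rw [hsum, ENNReal.inv_mul_cancel hA_ne_zero hA_ne_top]
  refine ⟨m, Function.update z true w, ?_, hfin, hsymm, hadm, ?_⟩
  · simpa [Bool.forall_bool, hz false] using hw.trans_lt (hz true)
  · exact Bool.forall_bool.2 ⟨(mul_comm _ _).trans hmul, hmul⟩

variable {M}

theorem exists_mixture_not_isSpectrallyDegenerateAlong {G : Type*} [Group G]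
    (e : G ≃* CoprodI M) (hM : ∃ i, Nat.card (M i) ≠ 2) :
    ∃ (α : PMF Bool) (m : ∀ i, PMF (M i)), (∀ i, α i ≠ 0) ∧ (∀ i, IsFinitelySupported (m i)) ∧
      (∀ i, IsSymmetric (m i)) ∧ (∀ i, IsAdmissible (m i)) ∧
      ∀ i, ¬ IsSpectrallyDegenerateAlong (mixture e α m) (factorHom e i).range := by
  obtain ⟨m, z, hz, hfin, hsymm, hadm, hcrit⟩ := exists_hittingSqSum_mul_eq_one M hM
  have hz_ne_zero : ∀ i, z i ≠ 0 := fun i h => by simpa [h, hittingSqSum_zero] using hcrit i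
  have hgreen := fun i => green_ne_top (m i) (hz i) 1
  obtain ⟨c, hc, hc', hcU⟩ := exists_add_mul_eq_one
    (fun i => returnGen_add_inv_green (hgreen i)) fun i => ENNReal.inv_ne_zero.2 (hgreen i)
  obtain ⟨α, r, hα, hαr⟩ := exists_pmf_mul_eq (w := fun i => c i * z i)
    (fun i => mul_ne_zero (hc i) (hz_ne_zero i))
    fun i => ENNReal.mul_ne_top (hc' i) (hz i).ne_top
  have hR := walkR_mixture_le e hsymm hz hαr hcU hcrit
  refine ⟨α, m, hα, hfin, hsymm, hadm, fun i => ?_⟩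
  refine not_isSpectrallyDegenerateAlong_range e hsymm hz hαr hcU hR ?_
  simpa using ENNReal.mul_lt_mul_right (hc i) (hc' i) (hz i)

end Existence

section BinaryFreeProduct

universe u v

/-- The two factors of a free product as a family of types in a common universe. -/
def Factor (Γ₁ : Type u) (Γ₂ : Type v) : Bool → Type (max u v)
  | true => ULift.{v} Γ₁
  | false => ULift.{u} Γ₂

variable {Γ₁ : Type u} {Γ₂ : Type v} [Group Γ₁] [Group Γ₂]

instance Factor.group : ∀ i, Group (Factor Γ₁ Γ₂ i)
  | true => inferInstanceAs (Group (ULift.{v} Γ₁))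
  | false => inferInstanceAs (Group (ULift.{u} Γ₂))

/-- The member of the family at `true` is the first factor. -/
def Factor.equivLeft : Factor Γ₁ Γ₂ true ≃* Γ₁ := (MulEquiv.ulift : ULift.{v} Γ₁ ≃* Γ₁)

/-- The member of the family at `false` is the second factor. -/
def Factor.equivRight : Factor Γ₁ Γ₂ false ≃* Γ₂ := (MulEquiv.ulift : ULift.{u} Γ₂ ≃* Γ₂)

instance Factor.fg [Group.FG Γ₁] [Group.FG Γ₂] : ∀ i, Group.FG (Factor Γ₁ Γ₂ i)
  | true => Group.fg_of_surjective (f := equivLeft.symm.toMonoidHom) equivLeft.symm.surjective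
  | false => Group.fg_of_surjective (f := equivRight.symm.toMonoidHom) equivRight.symm.surjective

instance Factor.nontrivial [Nontrivial Γ₁] [Nontrivial Γ₂] : ∀ i, Nontrivial (Factor Γ₁ Γ₂ i)
  | true => equivLeft.toEquiv.nontrivial
  | false => equivRight.toEquiv.nontrivial

/-- The inclusions of the factors into the binary free product. -/
def Factor.toCoprod : ∀ i, Factor Γ₁ Γ₂ i →* Coprod Γ₁ Γ₂
  | true => Coprod.inl.comp Factor.equivLeft.toMonoidHom
  | false => Coprod.inr.comp Factor.equivRight.toMonoidHom

variable (Γ₁ Γ₂) in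
/-- The binary free product as an indexed free product. -/
def coprodEquiv : Coprod Γ₁ Γ₂ ≃* CoprodI (Factor Γ₁ Γ₂) :=
  MonoidHom.toMulEquiv
    (Coprod.lift
      ((of (i := true)).comp (Factor.equivLeft (Γ₁ := Γ₁) (Γ₂ := Γ₂)).symm.toMonoidHom)
      ((of (i := false)).comp (Factor.equivRight (Γ₁ := Γ₁) (Γ₂ := Γ₂)).symm.toMonoidHom))
    (CoprodI.lift Factor.toCoprod)
    (by apply Coprod.hom_ext <;> ext x <;> simp [Factor.toCoprod])
    (by
      apply CoprodI.ext_hom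
      rintro (_ | _) <;> ext x <;> simp [Factor.toCoprod])

theorem factorHom_coprodEquiv (i : Bool) :
    factorHom (coprodEquiv Γ₁ Γ₂) i = Factor.toCoprod i :=
  MonoidHom.ext fun a => CoprodI.lift_of (fi := Factor.toCoprod) a

theorem freeFactors_eq_range_factorHom :
    freeFactors Γ₁ Γ₂ = Set.range fun i => (factorHom (coprodEquiv Γ₁ Γ₂) i).range := by
  have hleft : (Factor.toCoprod (Γ₁ := Γ₁) (Γ₂ := Γ₂) true).range = Coprod.inl.range := by
    rw [Factor.toCoprod, MonoidHom.range_comp, MonoidHom.range_eq_top_of_surjective _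
      Factor.equivLeft.surjective, ← MonoidHom.range_eq_map]
  have hright : (Factor.toCoprod (Γ₁ := Γ₁) (Γ₂ := Γ₂) false).range = Coprod.inr.range := by
    rw [Factor.toCoprod, MonoidHom.range_comp, MonoidHom.range_eq_top_of_surjective _
      Factor.equivRight.surjective, ← MonoidHom.range_eq_map]
  simp_rw [factorHom_coprodEquiv]
  rw [Bool.range_eq, hleft, hright, Set.pair_comm, freeFactors]

theorem isAdapted_mixture {m : ∀ i, PMF (Factor Γ₁ Γ₂ i)} (hfin : ∀ i, IsFinitelySupported (m i))
    (hsymm : ∀ i, IsSymmetric (m i)) (hadm : ∀ i, IsAdmissible (m i)) (α : PMF Bool) :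
    IsAdapted (mixture (coprodEquiv Γ₁ Γ₂) α m) := by
  refine ⟨α true, α false, (m true).map Factor.equivLeft, (m false).map Factor.equivRight,
    (hfin true).map _,
    (hadm true).map (f := Factor.equivLeft.toMonoidHom) Factor.equivLeft.surjective,
    (hsymm true).map Factor.equivLeft.toMonoidHom, (hfin false).map _,
    (hadm false).map (f := Factor.equivRight.toMonoidHom) Factor.equivRight.surjective,
    (hsymm false).map Factor.equivRight.toMonoidHom, ?_, fun g => ?_⟩
  · simpa using α.tsum_coe
  · rw [mixture, PMF.bind_apply, tsum_fintype, Fintype.sum_bool, PMF.map_comp, PMF.map_comp,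
      factorHom_coprodEquiv, factorHom_coprodEquiv]
    rfl

end BinaryFreeProduct

end RatioLimit

end

theorem mainTheorem11 {Γ₁ Γ₂ : Type*} [Group Γ₁] [Group Γ₂] [Group.FG Γ₁] [Group.FG Γ₂]
    (hne : RatioLimit.IsNonElementaryFreeProduct Γ₁ Γ₂) :
    ∃ μ : PMF (Monoid.Coprod Γ₁ Γ₂),
      RatioLimit.IsFinitelySupported μ ∧ RatioLimit.IsSymmetric μ ∧
      RatioLimit.IsAdapted μ ∧ RatioLimit.IsAdmissible μ ∧
      RatioLimit.IsSpectrallyNonDegenerate μ (RatioLimit.freeFactors Γ₁ Γ₂) := by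
  obtain ⟨hΓ₁, hΓ₂, hcard⟩ := hne
  have hM : ∃ i, Nat.card (RatioLimit.Factor Γ₁ Γ₂ i) ≠ 2 := by
    by_contra! h
    exact hcard ⟨(Nat.card_congr RatioLimit.Factor.equivLeft.toEquiv).symm.trans (h true),
      (Nat.card_congr RatioLimit.Factor.equivRight.toEquiv).symm.trans (h false)⟩
  obtain ⟨α, m, hα, hfin, hsymm, hadm, hdeg⟩ :=
    RatioLimit.exists_mixture_not_isSpectrallyDegenerateAlong (RatioLimit.coprodEquiv Γ₁ Γ₂) hM
  refine ⟨RatioLimit.mixture (RatioLimit.coprodEquiv Γ₁ Γ₂) α m, .mixture _ hfin α,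
    .mixture _ hsymm α, RatioLimit.isAdapted_mixture hfin hsymm hadm α, .mixture _ hα hadm, ?_⟩
  rw [RatioLimit.freeFactors_eq_range_factorHom]
  exact Set.forall_mem_range.2 hdeg
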